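/- **Setting.** Let $\Bbbk$ be an algebraically closed field. A $\Bbbk$-linear abelian category is *finite* if it is equivalent, $\Bbbk$-linearly, to the category of finite-dimensional left modules over a finite-dimensional $\Bbbk$-algebra. Let $\mathcal C$ be a finite tensor category over $\Bbbk$, i.e. a rigid monoidal category that is a finite abelian category, with $\Bbbk$-bilinear tensor product and simple unit object $\mathbf 1$. For $X\in\mathcal C$ let $X^*$ be the dual with evaluation $X^*\otimes X\to\mathbf 1$ and coevaluation $\mathbf 1\to X\otimes X^*$. An *exact left $\mathcal C$-module category* is a left $\mathcal C$-module category $\mathcal M$, with action $\triangleright$, that is a finite abelian category, whose action is $\Bbbk$-bilinear and right exact in each variable, and such that $P\triangleright M$ is projective for every $M\in\mathcal M$ and every projective $P\in\mathcal C$. *Internal Hom.* Let $\underline{\mathrm{Hom}}(M,-)$ denote a right adjoint of $\mathcal C\to\mathcal M$, $X\mapsto X\triangleright M$. The internal Hom carries canonical natural isomorphisms $\mathfrak a: X\otimes\underline{\mathrm{Hom}}(M,N)\to\underline{\mathrm{Hom}}(M,X\triangleright N)$, adjoint to $X\triangleright\mathrm{ev}$, and $\mathfrak b:\underline{\mathrm{Hom}}(M,N)\otimes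 X^*\to\underline{\mathrm{Hom}}(X\triangleright M,N)$, adjoint to the evaluation of $X$ followed by $\mathrm{ev}$, where $\mathrm{ev}:\underline{\mathrm{Hom}}(M,N)\triangleright M\to N$ is the counit. *Relative Serre functors.* A relative Serre functor of $\mathcal M$ is a functor $\mathsf S_{\mathcal M}:\mathcal M\to\mathcal M$ together with an isomorphism $\phi_{M,N}:\underline{\mathrm{Hom}}(M,N)^*\to\underline{\mathrm{Hom}}(N,\mathsf S_{\mathcal M}(M))$, natural in $M$ and $N$, which is compatible with the right $\mathcal C$-module structures in the variable $N$: $\phi_{M,Y\triangleright N}$ equals the composite $$\underline{\mathrm{Hom}}(M,Y\triangleright N)^*\xrightarrow{\mathfrak a^*}(Y\otimes\underline{\mathrm{Hom}}(M,N))^*\cong\underline{\mathrm{Hom}}(M,N)^*\otimes Y^*\xrightarrow{\phi\otimes Y^*}\underline{\mathrm{Hom}}(N,\mathsf S_{\mathcal M}(M))\otimes Y^*\xrightarrow{\mathfrak b}\underline{\mathrm{Hom}}(Y\triangleright N,\mathsf S_{\mathcal M}(M)).$$ Its *twisted module structure* is a natural isomorphism $\xi_{X,M}:X^{**}\triangleright\mathsf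 S_{\mathcal M}(M)\to\mathsf S_{\mathcal M}(X\triangleright M)$, coherent with the tensor product and unit of $\mathcal C$, for which $\phi$ is also compatible with the left $\mathcal C$-module structures: $\phi_{X\triangleright M,N}$ equals the composite $$\begin{aligned}\underline{\mathrm{Hom}}(X\triangleright M,N)^*&\xrightarrow{\mathfrak b^*}(\underline{\mathrm{Hom}}(M,N)\otimes X^*)^*\cong X^{**}\otimes\underline{\mathrm{Hom}}(M,N)^*\xrightarrow{X^{**}\otimes\phi}X^{**}\otimes\underline{\mathrm{Hom}}(N,\mathsf S_{\mathcal M}(M))\\&\xrightarrow{\mathfrak a}\underline{\mathrm{Hom}}(N,X^{**}\triangleright\mathsf S_{\mathcal M}(M))\xrightarrow{\underline{\mathrm{Hom}}(N,\xi)}\underline{\mathrm{Hom}}(N,\mathsf S_{\mathcal M}(X\triangleright M)).\end{aligned}$$ *Module functors.* For exact left $\mathcal C$-module categories $\mathcal M,\mathcal N$ let $\mathrm{Rex}_{\mathcal C}(\mathcal M,\mathcal N)$ be the category of $\Bbbk$-linear right exact left $\mathcal C$-module functors $\mathcal M\to\mathcal N$ (with invertible structure morphisms) and module natural transformations. For $F\in\mathrm{Rex}_{\mathcal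 C}(\mathcal M,\mathcal N)$ let $F^{r}\in\mathrm{Rex}_{\mathcal C}(\mathcal N,\mathcal M)$ be a right adjoint whose unit and counit are morphisms of module functors, and $F^{rr}=(F^r)^r$. Passing to mates, $(-)^r$ is contravariant and $(-)^{rr}$ covariant on natural transformations. For composable $E,F$ let $\gamma_{E,F}:E^r\circ F^r\to(F\circ E)^r$ be the canonical isomorphism given by uniqueness of right adjoints. **Theorem.** These notions are well defined: every exact left $\mathcal C$-module category has an internal Hom functor and a relative Serre functor, every relative Serre functor has a unique twisted module structure, and every $F\in\mathrm{Rex}_{\mathcal C}(\mathcal M,\mathcal N)$ has a right adjoint $F^r$ as above. Moreover, for all exact left $\mathcal C$-module categories $\mathcal M,\mathcal N$ (and all choices of internal Homs, relative Serre functors and right adjoints) there are isomorphisms of functors $$\theta_F:\mathsf S_{\mathcal N}\circ F\to F^{rr}\circ\mathsf S_{\mathcal M}\qquad(F\in\mathrm{Rex}_{\mathcal C}(\mathcal M,\mathcal N))$$ such that: 1. $\theta_F$ is natural in $F$: $\theta_{F_2}\circ(\mathsf S_{\mathcal N}\,\alpha)=(\alpha^{rr}\,\mathsf S_{\mathcal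 M})\circ\theta_{F_1}$ for every morphism $\alpha:F_1\to F_2$ in $\mathrm{Rex}_{\mathcal C}(\mathcal M,\mathcal N)$; 2. $\theta_F$ is an isomorphism of $(-)^{**}$-twisted left $\mathcal C$-module functors, where $\mathsf S_{\mathcal N}\circ F$ and $F^{rr}\circ\mathsf S_{\mathcal M}$ carry the structures composed from $\xi$ and the module structures of $F$ and $F^{rr}$; 3. for all exact left $\mathcal C$-module categories $\mathcal L,\mathcal M,\mathcal N$, all $E\in\mathrm{Rex}_{\mathcal C}(\mathcal L,\mathcal M)$ and all $F\in\mathrm{Rex}_{\mathcal C}(\mathcal M,\mathcal N)$, as morphisms $\mathsf S_{\mathcal N}\circ F\circ E\to(E^r\circ F^r)^r\circ\mathsf S_{\mathcal L}$, $$(\gamma_{F^r,E^r}\,\mathsf S_{\mathcal L})\circ(F^{rr}\,\theta_E)\circ(\theta_F\,E)=((\gamma_{E,F})^r\,\mathsf S_{\mathcal L})\circ\theta_{F\circ E}.$$ -/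

import Mathlib

open CategoryTheory CategoryTheory.MonoidalCategory CategoryTheory.Limits
open scoped CategoryTheory.MonoidalCategory.MonoidalLeftAction

universe w v₁ u₁ v₂ u₂

namespace RelativeSerre

/-! ### Finite abelian categories, finite tensor categories and exact module categories -/

/-- A `k`-linear abelian category is *finite* if it is equivalent, as a `k`-linear category, to the
category of finite-dimensional left modules over some finite-dimensional `k`-algebra `A`
(over such an `A`, a module is finitely generated iff it is finite-dimensional over `k`). -/
def IsFiniteAbelian (k : Type w) [Field k] (A : Type u₁) [Category.{v₁} A] [Abelian A]
    [Linear k A] : Prop :=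
  ∃ (R : Type w) (_ : Ring R) (_ : Algebra k R) (_ : Module.Finite k R)
    (e : A ≌ FGModuleCat.{w} R), e.functor.Additive ∧ e.functor.Linear k

/-- A finite tensor category over `k`: a rigid monoidal category which is a finite abelian category,
with `k`-bilinear tensor product and simple unit object. -/
class FiniteTensorCategory (k : Type w) [Field k] (C : Type u₁) [Category.{v₁} C] [Abelian C]
    [Linear k C] [MonoidalCategory C] [RigidCategory C] : Prop where
  finite : IsFiniteAbelian k C
  preadditive : MonoidalPreadditive C
  linear : MonoidalLinear k C
  simple_unit : Simple (𝟙_ C)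

/-- A finite left `C`-module category: a left `C`-module category which is a finite abelian category
and on which `C` acts `k`-bilinearly and right exactly in each variable.
Here `(curriedAction C M).obj X` is the functor `m ↦ X ⊙ₗ m`
and `(curriedAction C M).flip.obj m` is the functor `X ↦ X ⊙ₗ m`. -/
structure IsFiniteModuleCategory (k : Type w) [Field k] (C : Type u₁) [Category.{v₁} C]
    [Abelian C] [Linear k C] [MonoidalCategory C]
    (M : Type u₂) [Category.{v₂} M] [Abelian M] [Linear k M] [MonoidalLeftAction C M] : Prop where
  finite : IsFiniteAbelian k M
  additive_left (X : C) : ((MonoidalLeftAction.curriedAction C M).obj X).Additive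
  linear_left (X : C) : ((MonoidalLeftAction.curriedAction C M).obj X).Linear k
  rightExact_left (X : C) : PreservesFiniteColimits ((MonoidalLeftAction.curriedAction C M).obj X)
  additive_right (m : M) : ((MonoidalLeftAction.curriedAction C M).flip.obj m).Additive
  linear_right (m : M) : ((MonoidalLeftAction.curriedAction C M).flip.obj m).Linear k
  rightExact_right (m : M) :
    PreservesFiniteColimits ((MonoidalLeftAction.curriedAction C M).flip.obj m)

/-- An exact left `C`-module category. -/
structure ExactModuleCategory (k : Type w) [Field k] (C : Type u₁) [Category.{v₁} C]
    [Abelian C] [Linear k C] [MonoidalCategory C] where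
  carrier : Type u₂
  [category : Category.{v₂} carrier]
  [abelian : Abelian carrier]
  [linear : Linear k carrier]
  [action : MonoidalLeftAction C carrier]
  isFinite : IsFiniteModuleCategory k C carrier
  projective_action (P : C) (m : carrier) : Projective P → Projective (P ⊙ₗ m)

attribute [instance] ExactModuleCategory.category ExactModuleCategory.abelian
  ExactModuleCategory.linear ExactModuleCategory.action

instance (k : Type w) [Field k] (C : Type u₁) [Category.{v₁} C]
    [Abelian C] [Linear k C] [MonoidalCategory C] :
    CoeSort (ExactModuleCategory.{w, v₁, u₁, v₂, u₂} k C) (Type u₂) :=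
  ⟨ExactModuleCategory.carrier⟩

/-! ### Duals

`dual X` is the object `X*` with evaluation `X* ⊗ X ⟶ 𝟙` and coevaluation `𝟙 ⟶ X ⊗ X*`
(a *left* dual object in the terminology of Etingof–Gelaki–Nikshych–Ostrik,
the *right* dual in that of Mathlib). -/

section Duals

variable {C : Type u₁} [Category.{v₁} C] [MonoidalCategory C] [RigidCategory C]

/-- The dual object `X*`. -/
noncomputable def dual (X : C) : C := (RightRigidCategory.rightDual X).rightDual

/-- The evaluation `X* ⊗ X ⟶ 𝟙` and the coevaluation `𝟙 ⟶ X ⊗ X*`. -/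
noncomputable abbrev dualPairing (X : C) : ExactPairing X (dual X) :=
  (RightRigidCategory.rightDual X).exact

/-- The evaluation `X* ⊗ X ⟶ 𝟙`. -/
noncomputable def dualEval (X : C) : dual X ⊗ X ⟶ 𝟙_ C :=
  @ExactPairing.evaluation C _ _ X (dual X) (dualPairing X)

/-- The dual morphism `f* : Y* ⟶ X*` of `f : X ⟶ Y`. -/
noncomputable def dualMap {X Y : C} (f : X ⟶ Y) : dual Y ⟶ dual X :=
  @rightAdjointMate C _ _ X Y (RightRigidCategory.rightDual X) (RightRigidCategory.rightDual Y) f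

/-- The canonical isomorphism `(X ⊗ Y)* ≅ Y* ⊗ X*`. -/
noncomputable def dualTensorIso (X Y : C) : dual (X ⊗ Y) ≅ dual Y ⊗ dual X :=
  rightDualIso (dualPairing (X ⊗ Y))
    (@ExactPairing.tensor C _ _ X Y (dual X) (dual Y) (dualPairing X) (dualPairing Y))

/-- The canonical isomorphism `𝟙* ≅ 𝟙`. -/
noncomputable def dualUnitIso : dual (𝟙_ C) ≅ 𝟙_ C :=
  rightDualIso (dualPairing (𝟙_ C)) exactPairingUnit

/-- The canonical morphism `(X ⊗ Y)** ⟶ X** ⊗ Y**`, part of the monoidal structure of the double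
dual functor. -/
noncomputable def doubleDualTensor (X Y : C) :
    dual (dual (X ⊗ Y)) ⟶ dual (dual X) ⊗ dual (dual Y) :=
  dualMap (dualTensorIso X Y).inv ≫ (dualTensorIso (dual Y) (dual X)).hom

/-- The canonical morphism `𝟙** ⟶ 𝟙`, part of the monoidal structure of the double
dual functor. -/
noncomputable def doubleDualUnit : dual (dual (𝟙_ C)) ⟶ 𝟙_ C :=
  dualMap (dualUnitIso (C := C)).inv ≫ (dualUnitIso (C := C)).hom

end Duals

/-! ### Internal Hom functors -/

section InternalHom

/-- Internal Homs of a left `C`-module category: for every object `m`, a right adjoint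
`Hom(m, -) : M ⥤ C` of the functor `X ↦ X ⊙ₗ m`. -/
structure InternalHom (C : Type u₁) [Category.{v₁} C] [MonoidalCategory C]
    (M : Type u₂) [Category.{v₂} M] [MonoidalLeftAction C M] where
  /-- The functor `Hom(m, -)`. -/
  ihom (m : M) : M ⥤ C
  /-- The adjunction `(- ⊙ₗ m) ⊣ Hom(m, -)`. -/
  adj (m : M) : (MonoidalLeftAction.curriedAction C M).flip.obj m ⊣ ihom m

namespace InternalHom

variable {C : Type u₁} [Category.{v₁} C] [MonoidalCategory C]
  {M : Type u₂} [Category.{v₂} M] [MonoidalLeftAction C M] (H : InternalHom C M)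

/-- The internal Hom object `Hom(m, n)`. -/
abbrev hom (m n : M) : C := (H.ihom m).obj n

/-- The internal evaluation `Hom(m, n) ⊙ₗ m ⟶ n`. -/
def ev (m n : M) : H.hom m n ⊙ₗ m ⟶ n := (H.adj m).counit.app n

/-- The morphism `X ⟶ Hom(m, n)` corresponding to `f : X ⊙ₗ m ⟶ n`. -/
def curry {X : C} {m n : M} (f : X ⊙ₗ m ⟶ n) : X ⟶ H.hom m n :=
  (H.adj m).homEquiv X n f

/-- Functoriality in the first variable: `Hom(f, n) : Hom(m', n) ⟶ Hom(m, n)` for `f : m ⟶ m'`,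
characterized by `Hom(f, n) ⊵ₗ m ≫ ev m n = Hom(m', n) ⊴ₗ f ≫ ev m' n`. -/
def precomp {m m' : M} (f : m ⟶ m') (n : M) : H.hom m' n ⟶ H.hom m n :=
  H.curry (H.hom m' n ⊴ₗ f ≫ H.ev m' n)

/-- The left `C`-module structure `𝔞 : X ⊗ Hom(m, n) ⟶ Hom(m, X ⊙ₗ n)`. -/
def leftMod (X : C) (m n : M) : X ⊗ H.hom m n ⟶ H.hom m (X ⊙ₗ n) :=
  H.curry ((αₗ X (H.hom m n) m).hom ≫ X ⊴ₗ H.ev m n)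

/-- The right `C`-module structure `𝔟 : Hom(m, n) ⊗ X* ⟶ Hom(X ⊙ₗ m, n)`, which corresponds to
`Hom(m, n) ⊗ X* ⊗ X ⊙ₗ m ⟶ Hom(m, n) ⊙ₗ m ⟶ n` (evaluation of `X`, then internal evaluation). -/
noncomputable def rightMod [RigidCategory C] (X : C) (m n : M) :
    H.hom m n ⊗ dual X ⟶ H.hom (X ⊙ₗ m) n :=
  H.curry ((αₗ (H.hom m n) (dual X) (X ⊙ₗ m)).hom ≫
    H.hom m n ⊴ₗ ((αₗ (dual X) X m).inv ≫ dualEval X ⊵ₗ m ≫ (λₗ m).hom) ≫ H.ev m n)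

end InternalHom

end InternalHom

/-! ### Relative Serre functors -/

section Serre

variable {C : Type u₁} [Category.{v₁} C] [MonoidalCategory C] [RigidCategory C]
  {M : Type u₂} [Category.{v₂} M] [MonoidalLeftAction C M]

/-- A `(-)**`-twisted left `C`-module functor structure on an endofunctor `S` of `M`: natural
isomorphisms `ξ : X** ⊙ₗ S m ≅ S (X ⊙ₗ m)`, coherent with the tensor product and the unit of `C`. -/
structure TwistedModuleStructure (C : Type u₁) [Category.{v₁} C] [MonoidalCategory C]
    [RigidCategory C] {M : Type u₂} [Category.{v₂} M] [MonoidalLeftAction C M] (S : M ⥤ M) where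
  ξ (X : C) (m : M) : dual (dual X) ⊙ₗ S.obj m ≅ S.obj (X ⊙ₗ m)
  ξ_naturality {X X' : C} (f : X ⟶ X') {m m' : M} (g : m ⟶ m') :
    (dualMap (dualMap f) ⊙ₗₘ S.map g) ≫ (ξ X' m').hom = (ξ X m).hom ≫ S.map (f ⊙ₗₘ g)
  ξ_tensor (X Y : C) (m : M) :
    (ξ (X ⊗ Y) m).hom ≫ S.map (αₗ X Y m).hom =
      doubleDualTensor X Y ⊵ₗ S.obj m ≫ (αₗ (dual (dual X)) (dual (dual Y)) (S.obj m)).hom ≫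
        dual (dual X) ⊴ₗ (ξ Y m).hom ≫ (ξ X (Y ⊙ₗ m)).hom
  ξ_unit (m : M) :
    (ξ (𝟙_ C) m).hom ≫ S.map (λₗ m).hom =
      doubleDualUnit (C := C) ⊵ₗ S.obj m ≫ (λₗ (S.obj m)).hom

/-- A relative Serre functor `(S, φ)` of `M`: a functor `S : M ⥤ M` and a natural isomorphism
`φ : Hom(m, n)* ≅ Hom(n, S m)` of right `C`-module functors in the variable `n`. -/
structure RelativeSerreFunctor (H : InternalHom C M) where
  S : M ⥤ M
  φ (m n : M) : dual (H.hom m n) ≅ H.hom n (S.obj m)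
  φ_naturality_left {m m' : M} (f : m ⟶ m') (n : M) :
    dualMap (H.precomp f n) ≫ (φ m' n).hom = (φ m n).hom ≫ (H.ihom n).map (S.map f)
  φ_naturality_right (m : M) {n n' : M} (g : n ⟶ n') :
    dualMap ((H.ihom m).map g) ≫ (φ m n).hom = (φ m n').hom ≫ H.precomp g (S.obj m)
  /-- `φ` respects the right `C`-module structures:
  `Hom(m, Y ⊙ₗ n)* ≅ (Y ⊗ Hom(m, n))* ≅ Hom(m, n)* ⊗ Y*` corresponds under `φ` to
  `Hom(Y ⊙ₗ n, S m) ≅ Hom(n, S m) ⊗ Y*`. -/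
  φ_rightMod (Y : C) (m n : M) :
    (φ m (Y ⊙ₗ n)).hom =
      dualMap (H.leftMod Y m n) ≫ (dualTensorIso Y (H.hom m n)).hom ≫
        (φ m n).hom ▷ dual Y ≫ H.rightMod Y n (S.obj m)

/-- The twisted left `C`-module structure `ξ` of `S` is the one for which `φ` also respects the left
`C`-module structures, and so is an isomorphism of `C`-bimodule functors:
`Hom(X ⊙ₗ m, n)* ≅ (Hom(m, n) ⊗ X*)* ≅ X** ⊗ Hom(m, n)*` corresponds under `φ` to
`Hom(n, S (X ⊙ₗ m)) ≅ Hom(n, X** ⊙ₗ S m) ≅ X** ⊗ Hom(n, S m)`. -/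
def RelativeSerreFunctor.IsTwist {H : InternalHom C M} (𝒮 : RelativeSerreFunctor H)
    (t : TwistedModuleStructure C 𝒮.S) : Prop :=
  ∀ (X : C) (m n : M),
    (𝒮.φ (X ⊙ₗ m) n).hom =
      dualMap (H.rightMod X m n) ≫ (dualTensorIso (H.hom m n) (dual X)).hom ≫
        dual (dual X) ◁ (𝒮.φ m n).hom ≫ H.leftMod (dual (dual X)) n (𝒮.S.obj m) ≫
          (H.ihom n).map (t.ξ X m).hom

end Serre

/-! ### Right exact module functors and their right adjoints -/

section Rex

open Functor.LaxLeftLinear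

variable {k : Type w} [Field k] {C : Type u₁} [Category.{v₁} C]
  [Abelian C] [Linear k C] [MonoidalCategory C]

/-- The objects of `Rex_C(M, N)`: `k`-linear right exact (strong) left `C`-module functors. The
structure morphism `X ⊙ₗ F m ⟶ F (X ⊙ₗ m)` is `μₗ F.functor X m`. -/
structure Rex (M N : ExactModuleCategory.{w, v₁, u₁, v₂, u₂} k C) where
  functor : M ⥤ N
  [leftLinear : functor.LeftLinear C]
  [additive : functor.Additive]
  [linear : functor.Linear k]
  [rightExact : PreservesFiniteColimits functor]

attribute [instance] Rex.leftLinear Rex.additive Rex.linear Rex.rightExact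

namespace Rex

variable {L M N : ExactModuleCategory.{w, v₁, u₁, v₂, u₂} k C}

/-- Morphisms of `Rex_C(M, N)`: natural transformations which commute with the structure
morphisms of the module functors. -/
def IsModuleHom {F F' : Rex M N} (α : F.functor ⟶ F'.functor) : Prop :=
  ∀ (X : C) (m : M), μₗ F.functor X m ≫ α.app (X ⊙ₗ m) = X ⊴ₗ α.app m ≫ μₗ F'.functor X m

/-- The composite of `E : L ⥤ M` and `F : M ⥤ N` (first `E`, then `F`), with the structure morphism
`X ⊙ₗ F (E l) ⟶ F (X ⊙ₗ E l) ⟶ F (E (X ⊙ₗ l))`. -/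
def comp (E : Rex L M) (F : Rex M N) : Rex L N where
  functor := E.functor ⋙ F.functor
  leftLinear :=
    { μₗ X l := μₗ F.functor X (E.functor.obj l) ≫ F.functor.map (μₗ E.functor X l)
      δₗ X l := F.functor.map (Functor.OplaxLeftLinear.δₗ E.functor X l) ≫
        Functor.OplaxLeftLinear.δₗ F.functor X (E.functor.obj l)
      μₗ_naturality_left f l := by
        simp [← Functor.map_comp]
      μₗ_naturality_right X _ _ f := by
        simp [← Functor.map_comp]
      μₗ_associativity X Y l := by
        have h := congrArg F.functor.map (μₗ_associativity E.functor X Y l)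
        simp only [Functor.map_comp] at h
        simp [h]
      μₗ_unitality l := by
        simp
      δₗ_naturality_left f l := by
        have h := congrArg F.functor.map (Functor.OplaxLeftLinear.δₗ_naturality_left E.functor f l)
        simp only [Functor.map_comp] at h
        simp [reassoc_of% h]
      δₗ_naturality_right X _ _ f := by
        have h := congrArg F.functor.map (Functor.OplaxLeftLinear.δₗ_naturality_right E.functor X f)
        simp only [Functor.map_comp] at h
        simp [reassoc_of% h]
      δₗ_associativity X Y l := by
        have h := congrArg F.functor.map (Functor.OplaxLeftLinear.δₗ_associativity E.functor X Y l)
        simp only [Functor.map_comp] at h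
        simp [reassoc_of% h]
      δₗ_unitality_inv l := by
        simp
      μₗ_comp_δₗ X l := by simp [← Functor.map_comp_assoc]
      δₗ_comp_μₗ X l := by simp [← Functor.map_comp] }
  additive := inferInstance
  linear := inferInstance
  rightExact := comp_preservesFiniteColimits _ _

/-- A right adjoint of `F` in `Rex_C`: a functor `G` in `Rex_C(N, M)` with an adjunction
`F ⊣ G` whose unit and counit are morphisms of left `C`-module functors. -/
structure RightAdjoint (F : Rex M N) where
  right : Rex N M
  adj : F.functor ⊣ right.functor
  unit_app (X : C) (m : M) :
    adj.unit.app (X ⊙ₗ m) =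
      X ⊴ₗ adj.unit.app m ≫ μₗ right.functor X (F.functor.obj m) ≫
        right.functor.map (μₗ F.functor X m)
  counit_app (X : C) (n : N) :
    μₗ F.functor X (right.functor.obj n) ≫ F.functor.map (μₗ right.functor X n) ≫
      adj.counit.app (X ⊙ₗ n) = X ⊴ₗ adj.counit.app n

/-- For `α : F ⟶ F'`, the induced morphism `αʳ : F'ʳ ⟶ Fʳ` between right adjoints. -/
def RightAdjoint.map {F F' : Rex M N} (G : RightAdjoint F) (G' : RightAdjoint F')
    (α : F.functor ⟶ F'.functor) : G'.right.functor ⟶ G.right.functor :=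
  conjugateEquiv G'.adj G.adj α

/-- The canonical isomorphism `γ : Eʳ ∘ Fʳ ≅ (F ∘ E)ʳ`. -/
def RightAdjoint.γ {E : Rex L M} {F : Rex M N} (E' : RightAdjoint E) (F' : RightAdjoint F)
    (K : RightAdjoint (E.comp F)) :
    (F'.right.comp E'.right).functor ≅ K.right.functor :=
  (E'.adj.comp F'.adj).rightAdjointUniq K.adj

end Rex

end Rex

/-! ### The comparison isomorphism -/

section Comparison

open Functor.LaxLeftLinear

variable {k : Type w} [Field k] {C : Type u₁} [Category.{v₁} C]
  [Abelian C] [Linear k C] [MonoidalCategory C] [RigidCategory C]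

/-- A family of isomorphisms `θ_F : S_N ∘ F ≅ Fʳʳ ∘ S_M`, for all exact module categories `M`, `N`
with relative Serre functors `𝒮`, `𝒯`, and all `F` in `Rex_C(M, N)` with right adjoint `G = Fʳ` and
double right adjoint `G' = Fʳʳ`. -/
abbrev ComparisonFamily (k : Type w) [Field k] (C : Type u₁) [Category.{v₁} C]
    [Abelian C] [Linear k C] [MonoidalCategory C] [RigidCategory C] :=
  ∀ ⦃M N : ExactModuleCategory.{w, v₁, u₁, v₂, u₂} k C⦄ ⦃HM : InternalHom C M⦄
    ⦃HN : InternalHom C N⦄ (𝒮 : RelativeSerreFunctor HM) (𝒯 : RelativeSerreFunctor HN)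
    (F : Rex M N) (G : F.RightAdjoint) (G' : G.right.RightAdjoint),
    F.functor ⋙ 𝒯.S ≅ 𝒮.S ⋙ G'.right.functor

namespace ComparisonFamily

/-- `θ_F` is natural in `F`. -/
def IsNatural (θ : ComparisonFamily.{w, v₁, u₁, v₂, u₂} k C) : Prop :=
  ∀ ⦃M N : ExactModuleCategory.{w, v₁, u₁, v₂, u₂} k C⦄ ⦃HM : InternalHom C M⦄
    ⦃HN : InternalHom C N⦄ (𝒮 : RelativeSerreFunctor HM) (𝒯 : RelativeSerreFunctor HN)
    (F₁ F₂ : Rex M N) (G₁ : F₁.RightAdjoint) (G₁' : G₁.right.RightAdjoint)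
    (G₂ : F₂.RightAdjoint) (G₂' : G₂.right.RightAdjoint)
    (α : F₁.functor ⟶ F₂.functor), Rex.IsModuleHom α →
    Functor.whiskerRight α 𝒯.S ≫ (θ 𝒮 𝒯 F₂ G₂ G₂').hom =
      (θ 𝒮 𝒯 F₁ G₁ G₁').hom ≫ Functor.whiskerLeft 𝒮.S (G₂'.map G₁' (G₁.map G₂ α))

/-- `θ_F` is an isomorphism of twisted left `C`-module functors, where `S_N ∘ F` has the structure
`X** ⊙ₗ S_N (F m) ⟶ S_N (X ⊙ₗ F m) ⟶ S_N (F (X ⊙ₗ m))` and `Fʳʳ ∘ S_M` has the structure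
`X** ⊙ₗ Fʳʳ (S_M m) ⟶ Fʳʳ (X** ⊙ₗ S_M m) ⟶ Fʳʳ (S_M (X ⊙ₗ m))`. -/
def IsTwistedModuleHom (θ : ComparisonFamily.{w, v₁, u₁, v₂, u₂} k C) : Prop :=
  ∀ ⦃M N : ExactModuleCategory.{w, v₁, u₁, v₂, u₂} k C⦄ ⦃HM : InternalHom C M⦄
    ⦃HN : InternalHom C N⦄ (𝒮 : RelativeSerreFunctor HM) (𝒯 : RelativeSerreFunctor HN)
    (s : TwistedModuleStructure C 𝒮.S) (t : TwistedModuleStructure C 𝒯.S),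
    𝒮.IsTwist s → 𝒯.IsTwist t →
    ∀ (F : Rex M N) (G : F.RightAdjoint) (G' : G.right.RightAdjoint) (X : C) (m : M),
    (t.ξ X (F.functor.obj m)).hom ≫ 𝒯.S.map (μₗ F.functor X m) ≫
        (θ 𝒮 𝒯 F G G').hom.app (X ⊙ₗ m) =
      dual (dual X) ⊴ₗ (θ 𝒮 𝒯 F G G').hom.app m ≫
        μₗ G'.right.functor (dual (dual X)) (𝒮.S.obj m) ≫ G'.right.functor.map (s.ξ X m).hom

/-- Compatibility of `θ` with composition. Here `E' = Eʳ`, `E'' = Eʳʳ`, `F' = Fʳ`, `F'' = Fʳʳ`,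
`K' = (F ∘ E)ʳ`, `K'' = (F ∘ E)ʳʳ` and `R = (Eʳ ∘ Fʳ)ʳ`. -/
def IsCompatibleWithComp (θ : ComparisonFamily.{w, v₁, u₁, v₂, u₂} k C) : Prop :=
  ∀ ⦃L M N : ExactModuleCategory.{w, v₁, u₁, v₂, u₂} k C⦄ ⦃HL : InternalHom C L⦄
    ⦃HM : InternalHom C M⦄ ⦃HN : InternalHom C N⦄ (ℛ : RelativeSerreFunctor HL)
    (𝒮 : RelativeSerreFunctor HM) (𝒯 : RelativeSerreFunctor HN)
    (E : Rex L M) (E' : E.RightAdjoint) (E'' : E'.right.RightAdjoint)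
    (F : Rex M N) (F' : F.RightAdjoint) (F'' : F'.right.RightAdjoint)
    (K' : (E.comp F).RightAdjoint) (K'' : K'.right.RightAdjoint)
    (R : (F'.right.comp E'.right).RightAdjoint) (l : L),
    (θ 𝒮 𝒯 F F' F'').hom.app (E.functor.obj l) ≫
        F''.right.functor.map ((θ ℛ 𝒮 E E' E'').hom.app l) ≫
          (F''.γ E'' R).hom.app (ℛ.S.obj l) =
      (θ ℛ 𝒯 (E.comp F) K' K'').hom.app l ≫
        (R.map K'' (E'.γ F' K').hom).app (ℛ.S.obj l)

end ComparisonFamily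

end Comparison

end RelativeSerre

open RelativeSerre

-- Everything is reduced to traces. By a Yoneda argument, `φ` amounts to a natural family of forms
-- Hom(m, S m) ⟶ 𝟙 through which every form Hom(m, n) ⟶ 𝟙 is induced by a unique morphism n ⟶ S m
-- (`PartialTrace`). Equivalently, every f : Y ⊙ₗ m ⟶ S m has a trace Y ⟶ 𝟙, this trace is cyclic in
-- m (`tr_map`), and a morphism into S m is determined by the traces of its composites (`hom_ext`,
-- `hom_ext_action`). `RelativeSerreFunctor.trace` and `PartialTrace.relativeSerreFunctor` pass
-- between the two descriptions.
--
-- Existence: a right exact linear functor from a finite abelian category to a category with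
-- finite-dimensional Homs has a right adjoint (`IsFiniteAbelian.isLeftAdjoint`). This yields
-- internal Homs and right adjoints of module functors. Moreover an additive module functor out of
-- an exact module category is automatically right exact, because acting by a nonzero projective of
-- C splits short exact sequences in the source and is faithful on the target. Hence Hom(m, -) has a
-- right adjoint in its turn, and the value of that adjoint at 𝟙 is S m.
--
-- Twist: compatibility of `φ` with ξ says that the trace of X** ⊙ₗ h followed by ξ equals the trace
-- of h with its X-leg bent and evaluated against X** (`IsTwistMap`). The right side does not
-- involve ξ, so nondegeneracy of the trace gives existence, uniqueness and all coherence laws.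
--
-- Comparison: for F ⊣ G ⊣ G', a morphism Y ⊙ₗ m ⟶ G (T (F m)) transposes to Y ⊙ₗ F m ⟶ T (F m),
-- which has a trace. There is a unique v : G (T (F m)) ⟶ S m that produces these traces
-- (`comparison`), and θ is the transpose of v along G ⊣ G'. Invertibility follows from
-- nondegeneracy of both traces, and each of the three properties of θ becomes an equality of
-- traces.

universe v₃ u₃

namespace RelativeSerre

/-! ### Finite abelian categories and right adjoints of right exact functors -/

section FiniteAbelian

attribute [local instance] Abelian.hasFiniteBiproducts

variable {k : Type w} [Field k] {A : Type u₁} [Category.{v₁} A] [Abelian A] [Linear k A]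

/-- A projective object `P` of which every object is a quotient of a finite sum of copies. -/
structure IsProgenerator (P : A) : Prop where
  projective : Projective P
  exists_epi (X : A) : ∃ (n : ℕ) (p : (⨁ fun _ : Fin n => P) ⟶ X), Epi p

lemma IsProgenerator.eq_zero {P : A} (hP : IsProgenerator P) {X Y : A} (f : X ⟶ Y)
    (h : ∀ p : P ⟶ X, p ≫ f = 0) : f = 0 := by
  obtain ⟨n, p, hp⟩ := hP.exists_epi X
  rw [← cancel_epi p, comp_zero]
  ext i
  simpa using h (biproduct.ι (fun _ => P) i ≫ p)

open scoped ModuleCat in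
lemma finite_fgModuleCat_hom (R : Type w) [Ring R] [Algebra k R] [Module.Finite k R]
    (X Y : FGModuleCat.{w} R) : Module.Finite k (X ⟶ Y) := by
  have hX : Module.Finite k X.obj := Module.Finite.trans R X.obj
  have hY : Module.Finite k Y.obj := Module.Finite.trans R Y.obj
  let φ : (X ⟶ Y) →ₗ[k] (X.obj →ₗ[k] Y.obj) :=
    { toFun := fun f => f.hom.hom.restrictScalars k
      map_add' := fun _ _ => rfl
      map_smul' := fun _ _ => rfl }
  refine Module.Finite.of_injective φ fun f g h => ?_
  ext x
  exact LinearMap.congr_fun h x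

variable (k A) in
lemma IsFiniteAbelian.finite_hom (hA : IsFiniteAbelian k A) (X Y : A) :
    Module.Finite k (X ⟶ Y) := by
  obtain ⟨R, _, _, _, e, he, he'⟩ := hA
  have := finite_fgModuleCat_hom (k := k) R (e.functor.obj X) (e.functor.obj Y)
  exact Module.Finite.of_injective (e.functor.mapLinearMap k (X := X) (Y := Y))
    e.functor.map_injective

/-- The quotient by the range is again finitely generated, and the projection to it agrees with 0
after the epimorphism. -/
lemma fgModuleCat_surjective_of_epi {R : Type w} [Ring R] {X Y : FGModuleCat.{w} R} (f : X ⟶ Y)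
    [Epi f] : Function.Surjective f.hom.hom := by
  rw [← LinearMap.range_eq_top]
  let q : Y ⟶ FGModuleCat.of R (Y.obj ⧸ LinearMap.range f.hom.hom) :=
    FGModuleCat.ofHom (LinearMap.range f.hom.hom).mkQ
  have h : f ≫ q = f ≫ 0 := by
    ext x
    exact (Submodule.Quotient.mk_eq_zero _).2 ⟨x, rfl⟩
  have h' : q = 0 := by rwa [cancel_epi] at h
  rw [← Submodule.ker_mkQ (LinearMap.range f.hom.hom), LinearMap.ker_eq_top]
  exact congrArg (fun g => g.hom.hom) h'

-- The progenerator corresponds to the regular module R: lifting the image of 1 shows projectivity,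
-- and a finite generating family of a module gives the epimorphism from a finite sum.
variable (k A) in
lemma IsFiniteAbelian.exists_isProgenerator (hA : IsFiniteAbelian k A) :
    ∃ P : A, IsProgenerator P := by
  obtain ⟨R, _, _, _, e, he, he'⟩ := hA
  let P : FGModuleCat.{w} R := FGModuleCat.of R R
  have hP : Projective P := by
    refine ⟨fun {E X} f g _ => ?_⟩
    obtain ⟨y, hy⟩ := fgModuleCat_surjective_of_epi g (f.hom.hom (1 : R))
    refine ⟨FGModuleCat.ofHom (LinearMap.toSpanSingleton R E.obj y), ?_⟩
    ext
    change g.hom.hom ((1 : R) • y) = _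
    rw [one_smul, hy]
  refine ⟨e.inverse.obj P, ?_, fun X => ?_⟩
  · exact e.symm.map_projective_iff P |>.2 hP
  · obtain ⟨n, s, hs⟩ := Module.Finite.exists_fin (R := R) (M := (e.functor.obj X).obj)
    let g (i : Fin n) : P ⟶ e.functor.obj X :=
      FGModuleCat.ofHom (LinearMap.toSpanSingleton R _ (s i))
    let g' (i : Fin n) : e.inverse.obj P ⟶ X := e.inverse.map (g i) ≫ e.unitInv.app X
    refine ⟨n, biproduct.desc g', Preadditive.epi_of_cancel_zero _ fun {Y} f hf => ?_⟩
    have h1 (i : Fin n) : g i ≫ e.functor.map f = 0 := by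
      have h := biproduct.ι (fun _ => e.inverse.obj P) i ≫= hf
      rw [biproduct.ι_desc_assoc, comp_zero] at h
      apply e.inverse.map_injective
      simp only [Functor.map_comp, Equivalence.inv_fun_map, Functor.map_zero]
      rw [← Category.assoc, ← Category.assoc]
      exact h =≫ _ |>.trans zero_comp
    apply e.functor.map_injective
    rw [Functor.map_zero]
    ext x
    have hx : LinearMap.ker (e.functor.map f).hom.hom = ⊤ := by
      rw [eq_top_iff, ← hs, Submodule.span_le]
      rintro _ ⟨i, rfl⟩
      have h := congrArg (fun q => q.hom.hom (1 : R)) (h1 i)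
      change (e.functor.map f).hom.hom ((1 : R) • s i) = 0 at h
      rwa [one_smul] at h
    exact LinearMap.congr_fun (LinearMap.ker_eq_top.1 hx) x


/-! ### Right adjoints of right exact linear functors on a finite abelian category. -/

section RightAdjoint

variable {B : Type u₂} [Category.{v₂} B] [Preadditive B] [Linear k B]
  (K : A ⥤ B) [K.Additive] [K.Linear k] {P : A} (b : B)

-- Take one copy of P for each element of a finite spanning family of K P ⟶ b, and let x have that
-- family as components; coordinates then give the required f.
variable (k) in
lemma exists_weakly_universal (P : A) [Module.Finite k (K.obj P ⟶ b)] :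
    ∃ (Q : A) (x : K.obj Q ⟶ b), ∀ v : K.obj P ⟶ b, ∃ f : P ⟶ Q, K.map f ≫ x = v := by
  obtain ⟨n, v, hv⟩ := Module.Finite.exists_fin (R := k) (M := (K.obj P ⟶ b))
  refine ⟨⨁ fun _ : Fin n => P, ∑ i, K.map (biproduct.π (fun _ => P) i) ≫ v i, fun u => ?_⟩
  have hu : u ∈ Submodule.span k (Set.range v) := hv ▸ Submodule.mem_top
  induction hu using Submodule.span_induction with
  | mem u hu =>
    obtain ⟨j, rfl⟩ := hu
    refine ⟨biproduct.ι (fun _ => P) j, ?_⟩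
    rw [Preadditive.comp_sum, Finset.sum_eq_single j]
    · rw [← Functor.map_comp_assoc, biproduct.ι_π_self, CategoryTheory.Functor.map_id,
        Category.id_comp]
    · intro i _ hi
      rw [← Functor.map_comp_assoc, biproduct.ι_π_ne _ hi.symm, Functor.map_zero, zero_comp]
    · simp
  | zero => exact ⟨0, by simp⟩
  | add u u' _ _ h h' =>
    obtain ⟨⟨f, hf⟩, f', hf'⟩ := And.intro h h'
    exact ⟨f + f', by rw [Functor.map_add, Preadditive.add_comp, hf, hf']⟩
  | smul c u _ h =>
    obtain ⟨f, hf⟩ := h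
    exact ⟨c • f, by rw [Functor.map_smul, Linear.smul_comp, hf]⟩

-- Choose (Q, x) with dim Hom(P, Q) minimal. If x kills K j, then x factors through K (coker j) by
-- right exactness, and coker j is again weakly universal. By minimality the surjection Hom(P, Q) →
-- Hom(P, coker j) is bijective, so every P ⟶ L ⟶ Q vanishes and j = 0.
variable (k) in
lemma IsProgenerator.exists_reduced_weakly_universal (hP : IsProgenerator P)
    [∀ X : A, Module.Finite k (P ⟶ X)] [PreservesFiniteColimits K]
    [Module.Finite k (K.obj P ⟶ b)] :
    ∃ (Q : A) (x : K.obj Q ⟶ b), (∀ v : K.obj P ⟶ b, ∃ f : P ⟶ Q, K.map f ≫ x = v) ∧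
      ∀ (L : A) (j : L ⟶ Q), K.map j ≫ x = 0 → j = 0 := by
  let p (d : ℕ) : Prop := ∃ (Q : A) (x : K.obj Q ⟶ b),
    (∀ v : K.obj P ⟶ b, ∃ f : P ⟶ Q, K.map f ≫ x = v) ∧ Module.finrank k (P ⟶ Q) = d
  classical
  have hp : ∃ d, p d := by
    obtain ⟨Q, x, hx⟩ := exists_weakly_universal k K b P
    exact ⟨_, Q, x, hx, rfl⟩
  obtain ⟨Q, x, hx, hd⟩ := Nat.find_spec hp
  refine ⟨Q, x, hx, fun L j hj => ?_⟩
  obtain ⟨x', hx'⟩ : ∃ x' : K.obj (cokernel j) ⟶ b, K.map (cokernel.π j) ≫ x' = x := by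
    obtain ⟨x', hx'⟩ := CokernelCofork.IsColimit.desc'
      (CokernelCofork.mapIsColimit _ (cokernelIsCokernel j) K) x hj
    exact ⟨x', hx'⟩
  have hmin : Module.finrank k (P ⟶ Q) ≤ Module.finrank k (P ⟶ cokernel j) := by
    rw [hd]
    refine Nat.find_min' hp ⟨cokernel j, x', fun v => ?_, rfl⟩
    obtain ⟨f, hf⟩ := hx v
    exact ⟨f ≫ cokernel.π j, by rw [Functor.map_comp, Category.assoc, hx', hf]⟩
  let φ : (P ⟶ Q) →ₗ[k] (P ⟶ cokernel j) := Linear.rightComp k P (cokernel.π j)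
  have hφ : Function.Surjective φ := fun g => by
    have := hP.projective
    exact ⟨Projective.factorThru g (cokernel.π j), Projective.factorThru_comp _ _⟩
  have hφ' : Function.Injective φ :=
    (LinearMap.injective_iff_surjective_of_finrank_eq_finrank
      (le_antisymm hmin (LinearMap.finrank_le_finrank_of_surjective hφ))).2 hφ
  refine hP.eq_zero j fun q => hφ' ?_
  simp [φ]

-- The reduced pair (Q, x) is terminal. Uniqueness is reducedness applied to a difference. For
-- existence, cover Y by copies of P and choose a map to Q on each copy; the resulting map vanishes
-- on the kernel of the cover, again by reducedness, so it descends to Y.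
variable (k) in
lemma IsProgenerator.hasTerminal_costructuredArrow (hP : IsProgenerator P)
    [∀ X : A, Module.Finite k (P ⟶ X)] [PreservesFiniteColimits K]
    [Module.Finite k (K.obj P ⟶ b)] : HasTerminal (CostructuredArrow K b) := by
  obtain ⟨Q, x, hx, hx'⟩ := hP.exists_reduced_weakly_universal k K b
  have huniq {Y : A} {f g : Y ⟶ Q} (h : K.map f ≫ x = K.map g ≫ x) : f = g :=
    sub_eq_zero.1 (hx' _ _ (by rw [Functor.map_sub, Preadditive.sub_comp, h, sub_self]))
  have hex {Y : A} (y : K.obj Y ⟶ b) : ∃ f : Y ⟶ Q, K.map f ≫ x = y := by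
    obtain ⟨n, p, hp⟩ := hP.exists_epi Y
    choose f hf using fun i => hx (K.map (biproduct.ι (fun _ => P) i ≫ p) ≫ y)
    have hd : K.map (biproduct.desc f) ≫ x = K.map p ≫ y := by
      rw [← Category.id_comp (K.map _), ← Category.id_comp (K.map p),
        ← CategoryTheory.Functor.map_id, ← biproduct.total, Functor.map_sum]
      simp only [Preadditive.sum_comp, Category.assoc]
      refine Finset.sum_congr rfl fun i _ => ?_
      rw [Functor.map_comp, Category.assoc, ← Functor.map_comp_assoc _ _ (biproduct.desc f),
        biproduct.ι_desc, hf, Functor.map_comp]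
      simp only [Category.assoc]
    have hk : kernel.ι p ≫ biproduct.desc f = 0 := hx' _ _ (by
      rw [Functor.map_comp, Category.assoc, hd, ← Functor.map_comp_assoc, kernel.condition,
        Functor.map_zero, zero_comp])
    obtain ⟨g, hg⟩ : ∃ g, p ≫ g = biproduct.desc f :=
      ⟨_, (Abelian.epiIsCokernelOfKernel _ (kernelIsKernel p)).fac
        (CokernelCofork.ofπ _ hk) WalkingParallelPair.one⟩
    refine ⟨g, ?_⟩
    rw [← cancel_epi (K.map p), ← Functor.map_comp_assoc, hg, hd]
  refine IsTerminal.hasTerminal (X := CostructuredArrow.mk x)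
    (IsTerminal.ofUniqueHom (fun Y => CostructuredArrow.homMk (hex Y.hom).choose
      (hex Y.hom).choose_spec) fun Y m => ?_)
  ext
  exact huniq ((CostructuredArrow.w m).trans (hex Y.hom).choose_spec.symm)

/-- A right exact linear functor from a finite abelian category to a linear category with
finite-dimensional spaces of morphisms has a right adjoint. -/
lemma IsFiniteAbelian.isLeftAdjoint (hA : IsFiniteAbelian k A)
    (hB : ∀ X Y : B, Module.Finite k (X ⟶ Y)) [PreservesFiniteColimits K] : K.IsLeftAdjoint := by
  obtain ⟨P, hP⟩ := hA.exists_isProgenerator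
  have := hA.finite_hom
  have (b : B) : HasTerminal (CostructuredArrow K b) := hP.hasTerminal_costructuredArrow k K b
  exact isLeftAdjoint_of_costructuredArrowTerminals K

end RightAdjoint

end FiniteAbelian

/-! ### Actions of objects with duals -/

section ActionDuality

open Functor.LaxLeftLinear MonoidalLeftAction

variable {C : Type u₁} [Category.{v₁} C] [MonoidalCategory C]
  {M : Type u₂} [Category.{v₂} M] [MonoidalLeftAction C M]
  {N : Type u₃} [Category.{v₃} N] [MonoidalLeftAction C N]

/-- The unit `n ⟶ X ⊙ₗ Y ⊙ₗ n` of the adjunction `Y ⊙ₗ - ⊣ X ⊙ₗ -` of an exact pairing. -/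
def actionUnit (X Y : C) [ExactPairing X Y] (n : M) : n ⟶ X ⊙ₗ Y ⊙ₗ n :=
  (λₗ n).inv ≫ (η_ X Y) ⊵ₗ n ≫ (αₗ X Y n).hom

/-- The counit `Y ⊙ₗ X ⊙ₗ n ⟶ n` of the adjunction `Y ⊙ₗ - ⊣ X ⊙ₗ -` of an exact pairing. -/
def actionCounit (X Y : C) [ExactPairing X Y] (n : M) : Y ⊙ₗ X ⊙ₗ n ⟶ n :=
  (αₗ Y X n).inv ≫ (ε_ X Y) ⊵ₗ n ≫ (λₗ n).hom

lemma actionAssoc_inv_inv (X Y Z : C) (n : M) :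
    X ⊴ₗ (αₗ Y Z n).hom ≫ (αₗ X Y (Z ⊙ₗ n)).inv ≫ (αₗ (X ⊗ Y) Z n).inv =
      (αₗ X (Y ⊗ Z) n).inv ≫ (α_ X Y Z).inv ⊵ₗ n := by
  rw [Iso.eq_inv_comp]
  simp only [← Category.assoc]
  rw [Iso.comp_inv_eq, Iso.comp_inv_eq, Category.assoc, ← associator_actionHom,
    inv_hom_actionHomLeft_assoc]

variable (X Y : C) [ExactPairing X Y]

lemma actionUnit_naturality {n n' : M} (f : n ⟶ n') :
    f ≫ actionUnit X Y n' = actionUnit X Y n ≫ X ⊴ₗ Y ⊴ₗ f := by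
  simp only [actionUnit, Category.assoc]
  rw [← actionUnitIso_inv_naturality_assoc, action_exchange_assoc, tensor_actionHomRight]
  simp

lemma actionCounit_naturality {n n' : M} (f : n ⟶ n') :
    Y ⊴ₗ X ⊴ₗ f ≫ actionCounit X Y n' = actionCounit X Y n ≫ f := by
  simp only [actionCounit, Category.assoc]
  rw [actionUnitIso_hom_naturality, ← action_exchange_assoc, tensor_actionHomRight]
  simp

/-- This is a zigzag identity of the exact pairing, acting on n. -/
lemma actionUnit_counit_left (n : M) :
    Y ⊴ₗ actionUnit X Y n ≫ actionCounit X Y (Y ⊙ₗ n) = 𝟙 _ := by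
  have h : (Y ◁ η_ X Y ≫ (α_ _ _ _).inv ≫ ε_ X Y ▷ Y) ⊵ₗ n = ((ρ_ Y).hom ≫ (λ_ Y).inv) ⊵ₗ n := by
    rw [ExactPairing.coevaluation_evaluation]
  rw [comp_actionHomLeft, comp_actionHomLeft, whiskerLeft_actionHomLeft] at h
  simp only [Category.assoc] at h
  simp only [actionUnit, actionCounit, actionHomRight_comp, Category.assoc, actionHomLeft_action,
    reassoc_of% actionAssoc_inv_inv]
  have h' := (Iso.eq_inv_comp _).2 h =≫ ((αₗ _ _ _).hom ≫ (λₗ _).hom)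
  simp only [Category.assoc] at h'
  rw [h']
  simp [← leftUnitor_actionHom]

lemma actionUnit_counit_right (n : M) :
    actionUnit X Y (X ⊙ₗ n) ≫ X ⊴ₗ actionCounit X Y n = 𝟙 _ := by
  have h : (η_ X Y ▷ X ≫ (α_ _ _ _).hom ≫ X ◁ ε_ X Y) ⊵ₗ n = ((λ_ X).hom ≫ (ρ_ X).inv) ⊵ₗ n := by
    rw [ExactPairing.evaluation_coevaluation]
  rw [comp_actionHomLeft, comp_actionHomLeft, whiskerLeft_actionHomLeft] at h
  simp only [actionUnit, actionCounit, actionHomRight_comp, Category.assoc, actionHomLeft_action]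
  have h' := h =≫ ((αₗ X (𝟙_ C) n).hom ≫ X ⊴ₗ (λₗ n).hom)
  have h'' := associator_actionHom_assoc X Y X n (X ⊴ₗ (αₗ Y X n).inv)
  rw [actionHomRight_hom_inv, Category.comp_id] at h''
  simp only [Category.assoc, Iso.inv_hom_id_assoc] at h' h''
  rw [← reassoc_of% h'', h']
  rw [← rightUnitor_actionHom, comp_actionHomLeft, Category.assoc, inv_hom_actionHomLeft]
  simp

/-- The adjunction `Y ⊙ₗ - ⊣ X ⊙ₗ -` of an exact pairing. -/
def actionAdjunction : (curriedAction C M).obj Y ⊣ (curriedAction C M).obj X where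
  unit := { app n := actionUnit X Y n, naturality _ _ f := actionUnit_naturality X Y f }
  counit := { app n := actionCounit X Y n, naturality _ _ f := actionCounit_naturality X Y f }
  left_triangle_components n := actionUnit_counit_left X Y n
  right_triangle_components n := actionUnit_counit_right X Y n

variable (F : M ⥤ N) [F.LaxLeftLinear C]

lemma actionUnit_lineator (m : M) :
    actionUnit X Y (F.obj m) ≫ X ⊴ₗ μₗ F Y m ≫ μₗ F X (Y ⊙ₗ m) = F.map (actionUnit X Y m) := by
  simp only [actionUnit, Category.assoc, Functor.map_comp, ← μₗ_associativity,
    μₗ_naturality_left_assoc, μₗ_unitality_inv_assoc]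

lemma actionCounit_lineator (m : M) :
    Y ⊴ₗ μₗ F X m ≫ μₗ F Y (X ⊙ₗ m) ≫ F.map (actionCounit X Y m) =
      actionCounit X Y (F.obj m) := by
  simp [actionCounit]

/-- A lax module functor is strong on objects with a dual. -/
lemma isIso_lineator (X Y : C) [ExactPairing X Y] (F : M ⥤ N)
    [F.LaxLeftLinear C] (m : M) : IsIso (μₗ F X m) := by
  -- The inverse is the mate of the structure morphism at Y: F (X m) ⟶ X Y F (X m) ⟶ X F (Y X m) ⟶ X
  -- F m.
  refine ⟨actionUnit X Y _ ≫ X ⊴ₗ (μₗ F Y _ ≫ F.map (actionCounit X Y m)), ?_, ?_⟩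
  · rw [reassoc_of% actionUnit_naturality, ← actionHomRight_comp, actionCounit_lineator,
      actionUnit_counit_right]
  · rw [Category.assoc, actionHomRight_comp_assoc, μₗ_naturality_right,
      reassoc_of% actionUnit_lineator,
      ← Functor.map_comp, actionUnit_counit_right, CategoryTheory.Functor.map_id]

end ActionDuality

/-! ### Exactness of module functors -/

section Exactness

open Functor.LaxLeftLinear MonoidalLeftAction

variable {C : Type u₁} [Category.{v₁} C] [MonoidalCategory C] [RigidCategory C]
  {M : Type u₂} [Category.{v₂} M] [MonoidalLeftAction C M]
  {N : Type u₃} [Category.{v₃} N] [MonoidalLeftAction C N]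

instance (P : C) : PreservesFiniteColimits ((curriedAction C M).obj P) :=
  have := (actionAdjunction (M := M) (ᘁP) P).leftAdjoint_preservesColimits
  PreservesColimits.preservesFiniteColimits _

instance (P : C) : PreservesFiniteLimits ((curriedAction C M).obj P) :=
  have := (actionAdjunction (M := M) P Pᘁ).rightAdjoint_preservesLimits
  PreservesLimits.preservesFiniteLimits _

/-- Acting by a nonzero object is faithful. -/
lemma faithful_action [Abelian C] [Simple (𝟙_ C)] (P : C) (hP : 𝟙 P ≠ 0)
    [∀ n : N, ((curriedAction C N).flip.obj n).PreservesEpimorphisms] :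
    ((curriedAction C N).obj P).Faithful := by
  -- If the evaluation were zero, the zigzag identity would make the identity of P zero. Since 𝟙 is
  -- simple, a nonzero evaluation is an epimorphism.
  have hε : ε_ P Pᘁ ≠ 0 := fun h => hP (by
    have h' := ExactPairing.evaluation_coevaluation P Pᘁ
    have h'' : P ◁ ε_ P Pᘁ = 0 := by
      rw [h]
      exact ((curriedAction C C).obj P).map_zero _ _
    rw [h'', comp_zero, comp_zero, eq_comm, Iso.comp_inv_eq, zero_comp] at h'
    rw [← cancel_epi (λ_ P).hom, h', zero_comp, zero_comp])
  have : Epi (ε_ P Pᘁ) := epi_of_nonzero_to_simple hε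
  refine ⟨fun {n n'} f g hfg => ?_⟩
  change P ⊴ₗ f = P ⊴ₗ g at hfg
  have hepi : Epi (actionCounit P Pᘁ n) := by
    have : Epi (ε_ P Pᘁ ⊵ₗ n) :=
      inferInstanceAs (Epi (((curriedAction C N).flip.obj n).map (ε_ P Pᘁ)))
    unfold actionCounit
    infer_instance
  rw [← cancel_epi (actionCounit P Pᘁ n), ← actionCounit_naturality, hfg, actionCounit_naturality]

/-- An additive module functor is right exact if some projective object of `C` acts on the source by
objects that are projective and on the target faithfully. -/
lemma preservesFiniteColimits_of_projective_action [Abelian M] [Abelian N] (F : M ⥤ N) [F.Additive]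
    [F.LaxLeftLinear C] (P : C) [((curriedAction C M).obj P).Additive]
    [((curriedAction C N).obj P).Additive]
    (hP : ∀ m : M, Projective (P ⊙ₗ m)) [((curriedAction C N).obj P).Faithful] :
    PreservesFiniteColimits F := by
  rw [Functor.preservesFiniteColimits_iff_forall_exact_map_and_epi]
  intro S hS
  let T := (curriedAction C M).obj P
  let T' := (curriedAction C N).obj P
  have : Projective (S.map T).X₃ := hP _
  -- P ⊙ₗ S has projective third term, so it splits; hence the additive functor F keeps it exact.
  have s := ((hS.map_of_exact T).splittingOfProjective.map F).shortExact
  have hμ (m : M) : IsIso (μₗ F P m) := isIso_lineator P Pᘁ F m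
  let e : (S.map F).map T' ≅ (S.map T).map F := ShortComplex.isoMk
    (@asIso _ _ _ _ (μₗ F P S.X₁) (hμ _))
    (@asIso _ _ _ _ (μₗ F P S.X₂) (hμ _)) (@asIso _ _ _ _ (μₗ F P S.X₃) (hμ _))
    (μₗ_naturality_right F P S.f).symm
    (μₗ_naturality_right F P S.g).symm
  have s' := ShortComplex.shortExact_of_iso e.symm s
  have := s'.epi_g
  -- The sequence P ⊙ₗ F S is exact because it is isomorphic to F (P ⊙ₗ S), and the faithful exact
  -- functor P ⊙ₗ - reflects exactness and epimorphisms.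
  exact ⟨(ShortComplex.exact_map_iff_of_faithful _ T').1 s'.exact,
    T'.epi_of_epi_map (f := F.map S.g) this⟩

/-! ### Automatic right exactness over a finite tensor category. -/

section FiniteTensor

variable {k : Type w} [Field k] [Abelian C] [Linear k C]

variable (k C) in
lemma FiniteTensorCategory.exists_projective [FiniteTensorCategory k C] :
    ∃ P : C, Projective P ∧ 𝟙 P ≠ 0 := by
  obtain ⟨P, hP⟩ := (finite (k := k) (C := C)).exists_isProgenerator
  have := simple_unit (k := k) (C := C)
  refine ⟨P, hP.projective, fun h => id_nonzero (𝟙_ C) (hP.eq_zero _ fun p => ?_)⟩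
  rw [← Category.id_comp p, h, zero_comp, zero_comp]

/-- Additive module functors out of an exact module category are right exact. -/
lemma ExactModuleCategory.preservesFiniteColimits [FiniteTensorCategory k C]
    (M : ExactModuleCategory.{w, v₁, u₁, v₂, u₂} k C) [Abelian N]
    [∀ X : C, ((curriedAction C N).obj X).Additive]
    [∀ n : N, ((curriedAction C N).flip.obj n).PreservesEpimorphisms]
    (F : M ⥤ N) [F.Additive] [F.LaxLeftLinear C] : PreservesFiniteColimits F := by
  obtain ⟨P, hP, hP'⟩ := FiniteTensorCategory.exists_projective C k
  have := FiniteTensorCategory.simple_unit (k := k) (C := C)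
  have := M.isFinite.additive_left P
  have := faithful_action (N := N) P hP'
  exact preservesFiniteColimits_of_projective_action F P fun m => M.projective_action P m hP

end FiniteTensor

/-- This allows the exactness criterion to be used with C itself as the target, which is needed for
Hom(m, -). -/
instance (X : C) : ((curriedAction C C).flip.obj X).PreservesEpimorphisms :=
  have : (tensorRight X).IsLeftAdjoint := (tensorRightAdjunction X Xᘁ).isLeftAdjoint
  inferInstanceAs (tensorRight X).PreservesEpimorphisms

end Exactness

/-! ### Duals -/

section DualPairing

variable {C : Type u₁} [Category.{v₁} C] [MonoidalCategory C] [RigidCategory C]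

attribute [local instance] dualPairing

/-- The morphism `Z ⊗ X ⟶ 𝟙` corresponding to `s : Z ⟶ X*`. -/
noncomputable def pair {Z X : C} (s : Z ⟶ dual X) : Z ⊗ X ⟶ 𝟙_ C := s ▷ X ≫ dualEval X

/-- The morphism `Z ⟶ X*` corresponding to `t : Z ⊗ X ⟶ 𝟙`. -/
noncomputable def coname {Z X : C} (t : Z ⊗ X ⟶ 𝟙_ C) : Z ⟶ dual X :=
  tensorRightHomEquiv Z X (dual X) (𝟙_ C) t ≫ (λ_ (dual X)).hom

/-- The morphism `Z ⊗ X ⟶ W` corresponding to `f : Z ⟶ W ⊗ X*`. -/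
noncomputable def unbend {Z W X : C} (f : Z ⟶ W ⊗ dual X) : Z ⊗ X ⟶ W :=
  (tensorRightHomEquiv Z X (dual X) W).symm f

lemma unbend_eq {Z W X : C} (f : Z ⟶ W ⊗ dual X) :
    unbend f = f ▷ X ≫ (α_ _ _ _).hom ≫ W ◁ dualEval X ≫ (ρ_ W).hom := rfl

lemma unbend_comp {Z W W' X : C} (f : Z ⟶ W ⊗ dual X) (g : W ⟶ W') :
    unbend (f ≫ g ▷ dual X) = unbend f ≫ g := by
  simp only [unbend_eq, comp_whiskerRight, Category.assoc]
  rw [associator_naturality_left_assoc, ← whisker_exchange_assoc, rightUnitor_naturality]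

lemma pair_eq {Z X : C} (s : Z ⟶ dual X) : pair s = unbend (s ≫ (λ_ _).inv) := by
  simp only [pair, unbend_eq]
  monoidal

@[simp]
lemma pair_coname {Z X : C} (t : Z ⊗ X ⟶ 𝟙_ C) : pair (coname t) = t := by
  simp [pair_eq, coname, unbend]

@[simp]
lemma coname_pair {Z X : C} (s : Z ⟶ dual X) : coname (pair s) = s := by
  simp [pair_eq, coname, unbend]

lemma pair_injective {Z X : C} {s s' : Z ⟶ dual X} (h : pair s = pair s') : s = s' := by
  rw [← coname_pair s, h, coname_pair]

lemma whiskerRight_pair {Z' Z X : C} (f : Z' ⟶ Z) (s : Z ⟶ dual X) :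
    f ▷ X ≫ pair s = pair (f ≫ s) := by
  simp [pair]

lemma pair_id {X : C} : pair (𝟙 (dual X)) = dualEval X := by
  simp [pair]

lemma dualMap_eval {X Y : C} (f : X ⟶ Y) :
    dualMap f ▷ X ≫ dualEval X = dual Y ◁ f ≫ dualEval Y :=
  @rightAdjointMate_comp_evaluation C _ _ X Y (RightRigidCategory.rightDual X)
    (RightRigidCategory.rightDual Y) f

lemma pair_dualMap {Z X Y : C} (s : Z ⟶ dual Y) (f : X ⟶ Y) :
    pair (s ≫ dualMap f) = Z ◁ f ≫ pair s := by
  simp only [pair, comp_whiskerRight, Category.assoc, dualMap_eval]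
  rw [whisker_exchange_assoc]

/-- The comparison of two duals of X ⊗ Y is characterized by compatibility with their evaluations.
-/
lemma dualTensorIso_eval (X Y : C) :
    (dualTensorIso X Y).hom ▷ (X ⊗ Y) ≫ (α_ _ _ _).hom ≫ dual Y ◁ ((α_ _ _ _).inv ≫
      dualEval X ▷ Y ≫ (λ_ Y).hom) ≫ dualEval Y = dualEval (X ⊗ Y) := by
  have h := @rightAdjointMate_comp_evaluation C _ _ (X ⊗ Y) (X ⊗ Y)
    ⟨dual Y ⊗ dual X⟩ (RightRigidCategory.rightDual (X ⊗ Y)) (𝟙 _)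
  rw [whiskerLeft_id, Category.id_comp] at h
  refine Eq.trans (congrArg ((dualTensorIso X Y).hom ▷ (X ⊗ Y) ≫ ·) ?_) h
  change _ = 𝟙 _ ⊗≫ dual Y ◁ (dualEval X ▷ Y) ⊗≫ dualEval Y
  monoidal

/-- Pairing with X ⊗ Y may be carried out in two stages, contracting X first and then Y. -/
lemma pair_dualTensorIso {Z X Y : C} (s : Z ⟶ dual (X ⊗ Y)) :
    pair (unbend (s ≫ (dualTensorIso X Y).hom)) = (α_ Z X Y).hom ≫ pair s := by
  simp only [pair, unbend_eq]
  rw [← dualTensorIso_eval, ← comp_whiskerRight_assoc]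
  generalize s ≫ (dualTensorIso X Y).hom = r
  simp only [comp_whiskerRight, Category.assoc, MonoidalCategory.whiskerLeft_comp]
  have h : (r ▷ X) ▷ Y = (α_ Z X Y).hom ≫ r ▷ (X ⊗ Y) ≫ (α_ _ _ _).inv := by simp
  rw [h]
  monoidal

lemma dualUnitIso_eval : (dualUnitIso (C := C)).hom ▷ 𝟙_ C ≫ (ρ_ _).hom = dualEval (𝟙_ C) := by
  have h := @rightAdjointMate_comp_evaluation C _ _ (𝟙_ C) (𝟙_ C)
    ⟨𝟙_ C⟩ (RightRigidCategory.rightDual (𝟙_ C)) (𝟙 _)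
  rw [whiskerLeft_id, Category.id_comp] at h
  exact h

end DualPairing

/-! ### Calculus of internal Homs -/

section ActionAssoc

open MonoidalLeftAction

variable {C : Type u₁} [Category.{v₁} C] [MonoidalCategory C]
  {M : Type u₂} [Category.{v₂} M] [MonoidalLeftAction C M]

lemma actionAssoc_naturality_left {X X' : C} (f : X ⟶ X') (Y : C) (m : M) :
    (f ▷ Y) ⊵ₗ m ≫ (αₗ X' Y m).hom = (αₗ X Y m).hom ≫ f ⊵ₗ (Y ⊙ₗ m) := by
  simp

lemma actionAssoc_naturality_middle (X : C) {Y Y' : C} (f : Y ⟶ Y') (m : M) :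
    (X ◁ f) ⊵ₗ m ≫ (αₗ X Y' m).hom = (αₗ X Y m).hom ≫ X ⊴ₗ f ⊵ₗ m := by
  simp

lemma actionAssoc_naturality_right (X Y : C) {m m' : M} (f : m ⟶ m') :
    (X ⊗ Y) ⊴ₗ f ≫ (αₗ X Y m').hom = (αₗ X Y m).hom ≫ X ⊴ₗ Y ⊴ₗ f := by
  simp

end ActionAssoc

namespace InternalHom

open MonoidalLeftAction

attribute [local instance] dualPairing

variable {C : Type u₁} [Category.{v₁} C] [MonoidalCategory C]
  {M : Type u₂} [Category.{v₂} M] [MonoidalLeftAction C M] (H : InternalHom C M)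

/-- The morphism `X ⊙ₗ m ⟶ n` corresponding to `f : X ⟶ Hom(m, n)`. -/
def uncurry {X : C} {m n : M} (f : X ⟶ H.hom m n) : X ⊙ₗ m ⟶ n :=
  f ⊵ₗ m ≫ H.ev m n

@[simp]
lemma uncurry_curry {X : C} {m n : M} (f : X ⊙ₗ m ⟶ n) : H.uncurry (H.curry f) = f :=
  ((H.adj m).homEquiv_counit ..).symm.trans (((H.adj m).homEquiv X n).symm_apply_apply f)

@[simp]
lemma curry_uncurry {X : C} {m n : M} (f : X ⟶ H.hom m n) : H.curry (H.uncurry f) = f :=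
  (congrArg _ ((H.adj m).homEquiv_counit ..).symm).trans
    (((H.adj m).homEquiv X n).apply_symm_apply f)

lemma uncurry_injective {X : C} {m n : M} {f g : X ⟶ H.hom m n}
    (h : H.uncurry f = H.uncurry g) : f = g := by
  rw [← H.curry_uncurry f, h, H.curry_uncurry]

@[simp]
lemma curry_ev {X : C} {m n : M} (f : X ⊙ₗ m ⟶ n) : H.curry f ⊵ₗ m ≫ H.ev m n = f :=
  H.uncurry_curry f

@[simp]
lemma curry_ev_self (m n : M) : H.curry (H.ev m n) = 𝟙 _ :=
  H.uncurry_injective (by simp [uncurry])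

lemma uncurry_comp {X Y : C} {m n : M} (g : Y ⟶ X) (f : X ⟶ H.hom m n) :
    H.uncurry (g ≫ f) = g ⊵ₗ m ≫ H.uncurry f := by
  simp [uncurry]

lemma map_ev (m : M) {n n' : M} (f : n ⟶ n') :
    (H.ihom m).map f ⊵ₗ m ≫ H.ev m n' = H.ev m n ≫ f :=
  (H.adj m).counit.naturality f

lemma precomp_ev {m m' : M} (f : m ⟶ m') (n : M) :
    H.precomp f n ⊵ₗ m ≫ H.ev m n = H.hom m' n ⊴ₗ f ≫ H.ev m' n :=
  H.curry_ev _

lemma leftMod_ev (X : C) (m n : M) :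
    H.leftMod X m n ⊵ₗ m ≫ H.ev m (X ⊙ₗ n) = (αₗ _ _ _).hom ≫ X ⊴ₗ H.ev m n :=
  H.curry_ev _

lemma uncurry_map {X : C} {m n n' : M} (f : X ⟶ H.hom m n) (g : n ⟶ n') :
    H.uncurry (f ≫ (H.ihom m).map g) = H.uncurry f ≫ g := by
  simp [uncurry, map_ev]

lemma uncurry_precomp {X : C} {m m' n : M} (f : X ⟶ H.hom m' n) (g : m ⟶ m') :
    H.uncurry (f ≫ H.precomp g n) = X ⊴ₗ g ≫ H.uncurry f := by
  simp only [uncurry, comp_actionHomLeft, Category.assoc, precomp_ev]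
  rw [action_exchange_assoc]

lemma uncurry_leftMod (X : C) (m n : M) :
    H.uncurry (H.leftMod X m n) = (αₗ _ _ _).hom ≫ X ⊴ₗ H.ev m n :=
  H.uncurry_curry _

lemma uncurry_whiskerLeft_leftMod (X : C) {Y : C} {m n : M} (f : Y ⟶ H.hom m n) :
    H.uncurry (X ◁ f ≫ H.leftMod X m n) = (αₗ X Y m).hom ≫ X ⊴ₗ H.uncurry f := by
  simp [uncurry, leftMod_ev]

lemma comp_curry {X Y : C} {m n : M} (g : Y ⟶ X) (f : X ⊙ₗ m ⟶ n) :
    g ≫ H.curry f = H.curry (g ⊵ₗ m ≫ f) :=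
  H.uncurry_injective (by simp [uncurry])

lemma curry_map {X : C} {m n n' : M} (f : X ⊙ₗ m ⟶ n) (g : n ⟶ n') :
    H.curry f ≫ (H.ihom m).map g = H.curry (f ≫ g) :=
  H.uncurry_injective (by rw [uncurry_map]; simp)

lemma curry_precomp {X : C} {m m' n : M} (f : X ⊙ₗ m' ⟶ n) (g : m ⟶ m') :
    H.curry f ≫ H.precomp g n = H.curry (X ⊴ₗ g ≫ f) :=
  H.uncurry_injective (by rw [uncurry_precomp]; simp)

/-- Once Hom(m, -) is a lax module functor with structure 𝔞, rigidity makes 𝔞 invertible through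
`isIso_lineator`. -/
instance (m : M) : (H.ihom m).LaxLeftLinear C where
  μₗ X n := H.leftMod X m n
  μₗ_naturality_left {X X'} f n := H.uncurry_injective (by
    change H.uncurry (f ▷ H.hom m n ≫ H.leftMod X' m n) = _
    rw [uncurry_comp, uncurry_map, uncurry_leftMod, uncurry_leftMod,
      reassoc_of% actionAssoc_naturality_left, ← action_exchange, Category.assoc])
  μₗ_naturality_right X n n' f := H.uncurry_injective (by
    change H.uncurry (X ◁ (H.ihom m).map f ≫ H.leftMod X m n') = _
    rw [uncurry_comp, uncurry_map, uncurry_leftMod, uncurry_leftMod,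
      reassoc_of% actionAssoc_naturality_middle, ← actionHomRight_comp, map_ev, actionHomRight_comp,
      Category.assoc])
  μₗ_associativity X Y n := H.uncurry_injective (by
    change _ = H.uncurry ((α_ X Y (H.hom m n)).hom ≫ X ◁ H.leftMod Y m n ≫ H.leftMod X m (Y ⊙ₗ n))
    rw [uncurry_map, uncurry_leftMod, uncurry_comp, uncurry_whiskerLeft_leftMod, uncurry_leftMod,
      actionHomRight_comp, associator_actionHom_assoc, Category.assoc,
      actionAssoc_naturality_right])
  μₗ_unitality n := H.uncurry_injective (by
    change H.uncurry (λ_ (H.hom m n)).hom = _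
    rw [uncurry_map, uncurry_leftMod, Category.assoc, ← actionUnitIso_hom_naturality,
      ← leftUnitor_actionHom_assoc, uncurry])

instance [RigidCategory C] (X : C) (m n : M) : IsIso (H.leftMod X m n) :=
  isIso_lineator X Xᘁ (H.ihom m) n

/-- On generalized elements 𝔟 is the composite of bijections Y ⟶ Hom(m, n) ⊗ X*, then Y ⊗ X ⟶ Hom(m,
n), then Y ⊙ₗ X ⊙ₗ m ⟶ n. Its invertibility follows by Yoneda. -/
lemma uncurry_comp_rightMod [RigidCategory C] {X Y : C} {m n : M} (f : Y ⟶ H.hom m n ⊗ dual X) :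
    H.uncurry (f ≫ H.rightMod X m n) = (αₗ Y X m).inv ≫ H.uncurry (unbend f) := by
  simp only [uncurry, comp_actionHomLeft, Category.assoc, rightMod, curry_ev, unbend_eq]
  rw [actionHomLeft_action, Category.assoc, Category.assoc, Iso.cancel_iso_inv_left]
  congr 1
  rw [actionHomRight_comp, actionHomRight_comp, ← associator_actionHom_assoc]
  simp

instance [RigidCategory C] (X : C) (m n : M) : IsIso (H.rightMod X m n) := by
  refine isIso_of_yoneda_map_bijective _ fun Y => ⟨fun f g h => ?_, fun g => ?_⟩
  · have h' := congrArg H.uncurry h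
    simp only [uncurry_comp_rightMod, Iso.cancel_iso_inv_left] at h'
    exact (tensorRightHomEquiv _ _ _ _).symm.injective (H.uncurry_injective h')
  · refine ⟨tensorRightHomEquiv _ _ _ _ (H.curry ((αₗ Y X m).hom ≫ H.uncurry g)), ?_⟩
    refine H.uncurry_injective ?_
    simp only [uncurry_comp_rightMod, unbend, Equiv.symm_apply_apply, uncurry_curry,
      Iso.inv_hom_id_assoc]

end InternalHom

/-! ### Partial traces and relative Serre functors -/

section PartialTrace

open MonoidalLeftAction

variable {C : Type u₁} [Category.{v₁} C] [MonoidalCategory C]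
  {M : Type u₂} [Category.{v₂} M] [MonoidalLeftAction C M] {H : InternalHom C M}

variable (H) in
/-- A form `Hom(m, s) ⟶ 𝟙` is universal if it induces bijections between the morphisms `n ⟶ s` and
the forms `Hom(m, n) ⟶ 𝟙`. -/
def IsUniversalForm {m s : M} (l : H.hom m s ⟶ 𝟙_ C) : Prop :=
  ∀ n : M, Function.Bijective fun u : n ⟶ s => (H.ihom m).map u ≫ l

variable (H) in
/-- A partial trace on an endofunctor `S`: a natural family of universal forms
`Hom(m, S m) ⟶ 𝟙`. -/
structure PartialTrace (S : M ⥤ M) where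
  form (m : M) : H.hom m (S.obj m) ⟶ 𝟙_ C
  universal (m : M) : IsUniversalForm H (form m)
  naturality {m m' : M} (f : m ⟶ m') :
    H.precomp f (S.obj m) ≫ form m = (H.ihom m').map (S.map f) ≫ form m'

namespace PartialTrace

variable {S : M ⥤ M} (τ : PartialTrace H S)

/-- The trace `Y ⟶ 𝟙` of a morphism `Y ⊙ₗ m ⟶ S m`. -/
def tr {Y : C} {m : M} (f : Y ⊙ₗ m ⟶ S.obj m) : Y ⟶ 𝟙_ C := H.curry f ≫ τ.form m

lemma comp_tr {Y Y' : C} {m : M} (g : Y' ⟶ Y) (f : Y ⊙ₗ m ⟶ S.obj m) :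
    g ≫ τ.tr f = τ.tr (g ⊵ₗ m ≫ f) := by
  rw [tr, tr, ← Category.assoc, H.comp_curry]

lemma tr_map {Y : C} {m m' : M} (f : Y ⊙ₗ m' ⟶ S.obj m) (g : m ⟶ m') :
    τ.tr (f ≫ S.map g) = τ.tr (Y ⊴ₗ g ≫ f) := by
  rw [tr, tr, ← H.curry_map, ← H.curry_precomp, Category.assoc, Category.assoc, τ.naturality]

lemma tr_ev_comp {m n : M} (u : n ⟶ S.obj m) :
    τ.tr (H.ev m n ≫ u) = (H.ihom m).map u ≫ τ.form m := by
  rw [tr, ← H.curry_map, H.curry_ev_self, Category.id_comp]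

/-- Nondegeneracy of the trace; the single test morphism b = `ev` already suffices. -/
lemma hom_ext {m n : M} {u u' : n ⟶ S.obj m}
    (h : ∀ (Y : C) (b : Y ⊙ₗ m ⟶ n), τ.tr (b ≫ u) = τ.tr (b ≫ u')) : u = u' := by
  refine (τ.universal m n).1 ?_
  simpa only [tr_ev_comp] using h _ (H.ev m n)

lemma tr_eq_leftMod {A : C} {m n : M} (a : A ⊙ₗ n ⟶ S.obj m) :
    τ.tr ((αₗ A (H.hom m n) m).hom ≫ A ⊴ₗ H.ev m n ≫ a) =
      H.leftMod A m n ≫ (H.ihom m).map a ≫ τ.form m := by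
  rw [tr, ← Category.assoc, ← H.curry_map, Category.assoc, InternalHom.leftMod]

variable [RigidCategory C]

/-- Morphisms `A ⊙ₗ n ⟶ S m` correspond to forms `A ⊗ Hom(m, n) ⟶ 𝟙`. -/
lemma bijective_tr (A : C) (m n : M) : Function.Bijective fun a : A ⊙ₗ n ⟶ S.obj m =>
    τ.tr ((αₗ A (H.hom m n) m).hom ≫ A ⊴ₗ H.ev m n ≫ a) := by
  simp only [tr_eq_leftMod]
  exact (asIso (H.leftMod A m n)).homFromEquiv.symm.bijective.comp (τ.universal m (A ⊙ₗ n))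

lemma hom_ext_action {A : C} {m n : M} {a a' : A ⊙ₗ n ⟶ S.obj m}
    (h : ∀ (Y : C) (b : Y ⊙ₗ m ⟶ n), τ.tr ((αₗ A Y m).hom ≫ A ⊴ₗ b ≫ a) =
      τ.tr ((αₗ A Y m).hom ≫ A ⊴ₗ b ≫ a')) : a = a' :=
  (τ.bijective_tr A m n).1 (h _ _)

end PartialTrace

end PartialTrace

/-! ### The partial trace of a relative Serre functor. -/

section SerreToTrace

open MonoidalLeftAction

variable {C : Type u₁} [Category.{v₁} C] [MonoidalCategory C] [RigidCategory C]
  {M : Type u₂} [Category.{v₂} M] [MonoidalLeftAction C M] {H : InternalHom C M}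

namespace RelativeSerreFunctor

variable (𝒮 : RelativeSerreFunctor H)

/-- The form `Hom(m, S m) ⟶ 𝟙` of a relative Serre functor. -/
noncomputable def form (m : M) : H.hom m (𝒮.S.obj m) ⟶ 𝟙_ C :=
  (λ_ _).inv ≫ pair (H.curry (λₗ (𝒮.S.obj m)).hom ≫ (𝒮.φ m (𝒮.S.obj m)).inv)

/-- The form determines `φ`: naturality in n carries the element of Hom(m, S m)* that defines the
form along a, and compatibility with the right module structure at Y = A then moves A out of the
internal Hom. No left module compatibility is used. -/
lemma pair_curry_φ_inv {A : C} {m n : M} (a : A ⊙ₗ n ⟶ 𝒮.S.obj m) :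
    pair (H.curry a ≫ (𝒮.φ m n).inv) =
      H.leftMod A m n ≫ (H.ihom m).map a ≫ 𝒮.form m := by
  let j : 𝟙_ C ⟶ _ := H.curry (λₗ (𝒮.S.obj m)).hom ≫ (𝒮.φ m (𝒮.S.obj m)).inv
  let j' := (j ≫ dualMap ((H.ihom m).map a)) ≫ dualMap (H.leftMod A m n)
  let r := j' ≫ (dualTensorIso A (H.hom m n)).hom
  have h₀ : (j ≫ dualMap ((H.ihom m).map a)) ≫ (𝒮.φ m (A ⊙ₗ n)).hom =
      H.curry ((λₗ (A ⊙ₗ n)).hom ≫ a) := by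
    rw [Category.assoc, 𝒮.φ_naturality_right]
    simp only [j, Category.assoc, Iso.inv_hom_id_assoc]
    rw [H.curry_precomp, actionUnitIso_hom_naturality]
  have h₁ : H.curry a ≫ (𝒮.φ m n).inv = (λ_ A).inv ≫ unbend r := by
    rw [Iso.comp_inv_eq]
    apply H.uncurry_injective
    have h₂ : (r ≫ (𝒮.φ m n).hom ▷ dual A) ≫ H.rightMod A n (𝒮.S.obj m) =
        H.curry ((λₗ (A ⊙ₗ n)).hom ≫ a) := by
      rw [← h₀, 𝒮.φ_rightMod]
      simp only [r, j', Category.assoc]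
    replace h₂ := congrArg H.uncurry h₂
    rw [H.uncurry_comp_rightMod, unbend_comp, H.uncurry_curry, Iso.inv_comp_eq] at h₂
    rw [H.uncurry_curry, Category.assoc, H.uncurry_comp, h₂, ← leftUnitor_actionHom_assoc,
      inv_hom_actionHomLeft_assoc]
  rw [h₁, ← whiskerRight_pair, pair_dualTensorIso, pair_dualMap, pair_dualMap, form]
  simp [j]

lemma map_comp_form {m n : M} (u : n ⟶ 𝒮.S.obj m) : (H.ihom m).map u ≫ 𝒮.form m =
    (λ_ _).inv ≫ pair (H.curry ((λₗ n).hom ≫ u) ≫ (𝒮.φ m n).inv) := by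
  have h : H.leftMod (𝟙_ C) m n ≫ (H.ihom m).map (λₗ n).hom = (λ_ (H.hom m n)).hom :=
    (Functor.LaxLeftLinear.μₗ_unitality (C := C) (H.ihom m) n).symm
  rw [pair_curry_φ_inv, Functor.map_comp, Category.assoc, reassoc_of% h, Iso.inv_hom_id_assoc]

/-- The partial trace of a relative Serre functor. -/
noncomputable def trace : PartialTrace H 𝒮.S where
  form := 𝒮.form
  universal m n := by
    refine ⟨fun u u' h => ?_, fun t => ⟨(λₗ n).inv ≫
      H.uncurry (coname ((λ_ (H.hom m n)).hom ≫ t) ≫ (𝒮.φ m n).hom), ?_⟩⟩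
    · simp only [map_comp_form, Iso.cancel_iso_inv_left] at h
      have h' := congrArg H.uncurry ((cancel_mono _).1 (pair_injective h))
      simpa using h'
    · change (H.ihom m).map _ ≫ 𝒮.form m = t
      rw [map_comp_form]
      simp
  naturality {m m'} f := by
    have h : (H.ihom (𝒮.S.obj m)).map (𝒮.S.map f) ≫ (𝒮.φ m' (𝒮.S.obj m)).inv =
        (𝒮.φ m (𝒮.S.obj m)).inv ≫ dualMap (H.precomp f (𝒮.S.obj m)) := by
      rw [Iso.comp_inv_eq, Category.assoc, 𝒮.φ_naturality_left, Iso.inv_hom_id_assoc]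
    rw [map_comp_form, form, ← H.curry_map, Category.assoc, h, ← Category.assoc (H.curry _),
      pair_dualMap]
    simp

lemma pair_eq_tr {A : C} {m n : M} (g : A ⟶ dual (H.hom m n)) :
    pair g = 𝒮.trace.tr ((αₗ A (H.hom m n) m).hom ≫ A ⊴ₗ H.ev m n ≫
      H.uncurry (g ≫ (𝒮.φ m n).hom)) := by
  rw [PartialTrace.tr_eq_leftMod]
  refine Eq.trans ?_ (𝒮.pair_curry_φ_inv _)
  simp

end RelativeSerreFunctor

end SerreToTrace

/-! ### Existence of relative Serre functors -/

section TraceToSerre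

open MonoidalLeftAction

variable {C : Type u₁} [Category.{v₁} C] [MonoidalCategory C] [RigidCategory C]
  {M : Type u₂} [Category.{v₂} M] [MonoidalLeftAction C M] {H : InternalHom C M}

namespace PartialTrace

variable {S : M ⥤ M} (τ : PartialTrace H S)

/-- The morphism `Hom(n, S m) ⟶ Hom(m, n)*` given by the trace of the composite. -/
noncomputable def toDual (m n : M) : H.hom n (S.obj m) ⟶ dual (H.hom m n) :=
  coname (τ.tr ((αₗ (H.hom n (S.obj m)) (H.hom m n) m).hom ≫
    H.hom n (S.obj m) ⊴ₗ H.ev m n ≫ H.ev n (S.obj m)))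

lemma pair_comp_toDual {A : C} {m n : M} (f : A ⟶ H.hom n (S.obj m)) :
    pair (f ≫ τ.toDual m n) =
      τ.tr ((αₗ A (H.hom m n) m).hom ≫ A ⊴ₗ H.ev m n ≫ H.uncurry f) := by
  rw [← whiskerRight_pair, toDual, pair_coname, comp_tr, reassoc_of% actionAssoc_naturality_left,
    ← action_exchange_assoc, InternalHom.uncurry]

/-- On A-valued points this map is the bijection of `bijective_tr`. -/
instance (m n : M) : IsIso (τ.toDual m n) := by
  refine isIso_of_yoneda_map_bijective _ fun A => ⟨fun f g h => ?_, fun s => ?_⟩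
  · refine H.uncurry_injective ((τ.bijective_tr A m n).1 ?_)
    simpa only [pair_comp_toDual] using congrArg pair h
  · obtain ⟨a, ha⟩ := (τ.bijective_tr A m n).2 (pair s)
    refine ⟨H.curry a, pair_injective ?_⟩
    rw [pair_comp_toDual, H.uncurry_curry, ← ha]

/-- The isomorphism `Hom(m, n)* ≅ Hom(n, S m)` of a partial trace. -/
noncomputable def φ (m n : M) : dual (H.hom m n) ≅ H.hom n (S.obj m) :=
  (asIso (τ.toDual m n)).symm

lemma pair_eq_tr {A : C} {m n : M} (g : A ⟶ dual (H.hom m n)) :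
    pair g = τ.tr ((αₗ A (H.hom m n) m).hom ≫ A ⊴ₗ H.ev m n ≫
      H.uncurry (g ≫ (τ.φ m n).hom)) := by
  rw [← pair_comp_toDual]
  simp [φ]

lemma eq_of_tr {A : C} {m n : M} {f f' : A ⟶ H.hom n (S.obj m)}
    (h : τ.tr ((αₗ A (H.hom m n) m).hom ≫ A ⊴ₗ H.ev m n ≫ H.uncurry f) =
      τ.tr ((αₗ A (H.hom m n) m).hom ≫ A ⊴ₗ H.ev m n ≫ H.uncurry f')) : f = f' :=
  H.uncurry_injective ((τ.bijective_tr A m n).1 h)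

/-- The relative Serre functor of a partial trace. -/
noncomputable def relativeSerreFunctor : RelativeSerreFunctor H where
  S := S
  φ := τ.φ
  φ_naturality_left {m m'} f n := τ.eq_of_tr (by
    rw [← pair_eq_tr, ← Category.id_comp (dualMap _), pair_dualMap, pair_eq_tr, H.uncurry_map,
      Category.id_comp, comp_tr, reassoc_of% actionAssoc_naturality_middle,
      ← actionHomRight_comp_assoc,
      H.precomp_ev, actionHomRight_comp_assoc, ← reassoc_of% actionAssoc_naturality_right,
      ← τ.tr_map]
    simp only [Category.assoc])
  φ_naturality_right m {n n'} g := τ.eq_of_tr (by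
    rw [← pair_eq_tr, ← Category.id_comp (dualMap _), pair_dualMap, pair_eq_tr, H.uncurry_precomp,
      Category.id_comp, comp_tr, reassoc_of% actionAssoc_naturality_middle,
      ← actionHomRight_comp_assoc,
      H.map_ev, actionHomRight_comp_assoc])
  φ_rightMod Y m n := τ.eq_of_tr (by
    have h₁ := τ.pair_eq_tr (𝟙 (dual (H.hom m (Y ⊙ₗ n))))
    have h₂ : (αₗ (dual (H.hom m (Y ⊙ₗ n))) (Y ⊗ H.hom m n) m).hom ≫
        dual (H.hom m (Y ⊙ₗ n)) ⊴ₗ (αₗ Y (H.hom m n) m).hom =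
        (α_ _ _ _).inv ⊵ₗ m ≫ (αₗ (dual (H.hom m (Y ⊙ₗ n)) ⊗ Y) (H.hom m n) m).hom ≫
          (αₗ _ _ _).hom := by
      rw [← associator_actionHom, inv_hom_actionHomLeft_assoc]
    have h₃ := H.uncurry_comp_rightMod (X := Y) ((dualMap (H.leftMod Y m n) ≫
      (dualTensorIso Y (H.hom m n)).hom) ≫ (τ.φ m n).hom ▷ dual Y)
    rw [Category.id_comp] at h₁
    rw [unbend_comp] at h₃
    simp only [Category.assoc] at h₃
    -- Since 𝔞 is invertible, the two traces may be compared after precomposing with it; both become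
    -- the pairing that evaluates Y ⊗ Hom(m, n).
    rw [← cancel_epi (dual (H.hom m (Y ⊙ₗ n)) ◁ H.leftMod Y m n), ← h₁, ← pair_dualMap,
      Category.id_comp, comp_tr, reassoc_of% actionAssoc_naturality_middle,
      ← actionHomRight_comp_assoc,
      H.leftMod_ev, h₃, actionHomRight_comp_assoc, reassoc_of% h₂,
      ← reassoc_of% actionAssoc_naturality_right, Iso.hom_inv_id_assoc, ← comp_tr, ← pair_eq_tr,
      pair_dualTensorIso, Iso.inv_hom_id_assoc])

end PartialTrace

end TraceToSerre

/-! ### Partial traces from universal forms. -/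

section Existence

open MonoidalLeftAction

variable {C : Type u₁} [Category.{v₁} C] [MonoidalCategory C]
  {M : Type u₂} [Category.{v₂} M] [MonoidalLeftAction C M] {H : InternalHom C M}

lemma InternalHom.precomp_map (H : InternalHom C M) {m m' n n' : M} (f : m ⟶ m') (g : n ⟶ n') :
    H.precomp f n ≫ (H.ihom m).map g = (H.ihom m').map g ≫ H.precomp f n' :=
  H.uncurry_injective (by
    rw [H.uncurry_map, H.uncurry_precomp, uncurry, uncurry, H.precomp_ev, H.map_ev,
      Category.assoc])

lemma InternalHom.precomp_id (H : InternalHom C M) (m n : M) : H.precomp (𝟙 m) n = 𝟙 _ :=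
  H.uncurry_injective (by simp [uncurry, H.precomp_ev])

lemma InternalHom.precomp_comp (H : InternalHom C M) {m₁ m₂ m₃ : M} (f : m₁ ⟶ m₂) (g : m₂ ⟶ m₃)
    (n : M) : H.precomp (f ≫ g) n = H.precomp g n ≫ H.precomp f n :=
  H.uncurry_injective (by
    rw [H.uncurry_precomp, uncurry, uncurry, H.precomp_ev, H.precomp_ev, actionHomRight_comp,
      Category.assoc])

/-- Universal forms on the objects `Hom(m, s m)` assemble to a partial trace. -/
lemma exists_partialTrace (h : ∀ m : M, ∃ (s : M) (l : H.hom m s ⟶ 𝟙_ C), IsUniversalForm H l) :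
    ∃ S : M ⥤ M, Nonempty (PartialTrace H S) := by
  choose s l hl using h
  -- Naturality of the trace forces S g; universality supplies it, and its uniqueness part makes S a
  -- functor.
  choose f hf using fun (m m' : M) (g : m ⟶ m') => (hl m' (s m)).2 (H.precomp g (s m) ≫ l m)
  dsimp only at hf
  let S : M ⥤ M :=
    { obj := s
      map g := f _ _ g
      map_id m := (hl m _).1 (by
        dsimp only
        rw [hf, H.precomp_id, CategoryTheory.Functor.map_id])
      map_comp {m₁ m₂ m₃} g g' := (hl m₃ _).1 (by
        dsimp only
        rw [hf, Functor.map_comp, Category.assoc, hf, ← reassoc_of% H.precomp_map, hf,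
          H.precomp_comp, Category.assoc]) }
  exact ⟨S, ⟨{ form := l, universal := hl, naturality := fun g => (hf _ _ g).symm }⟩⟩

end Existence

/-! ### Existence of internal Homs and relative Serre functors. -/

section FiniteTensor

open MonoidalLeftAction

variable {k : Type w} [Field k] {C : Type u₁} [Category.{v₁} C] [Abelian C] [Linear k C]
  [MonoidalCategory C] [RigidCategory C] [FiniteTensorCategory k C]

lemma linear_right_adjoint {A : Type u₁} [Category.{v₁} A] [Preadditive A] [Linear k A]
    {B : Type u₂} [Category.{v₂} B] [Preadditive B] [Linear k B] {F : A ⥤ B} {G : B ⥤ A}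
    (adj : F ⊣ G) [F.Additive] [F.Linear k] : G.Linear k where
  map_smul f c := (adj.homEquiv _ _).symm.injective (by simp [Adjunction.homEquiv_counit])

lemma ExactModuleCategory.nonempty_internalHom (M : ExactModuleCategory.{w, v₁, u₁, v₂, u₂} k C) :
    Nonempty (InternalHom C M) := by
  have h (m : M) : ((curriedAction C M).flip.obj m).IsLeftAdjoint :=
    have := M.isFinite.additive_right m
    have := M.isFinite.linear_right m
    have := M.isFinite.rightExact_right m
    (FiniteTensorCategory.finite (k := k) (C := C)).isLeftAdjoint _ M.isFinite.finite.finite_hom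
  exact ⟨⟨fun m => ((curriedAction C M).flip.obj m).rightAdjoint,
    fun m => Adjunction.ofIsLeftAdjoint _⟩⟩

lemma ExactModuleCategory.nonempty_relativeSerreFunctor
    (M : ExactModuleCategory.{w, v₁, u₁, v₂, u₂} k C) (H : InternalHom C M) :
    Nonempty (RelativeSerreFunctor H) := by
  have := FiniteTensorCategory.preadditive (k := k) (C := C)
  suffices h : ∀ m : M, ∃ (s : M) (l : H.hom m s ⟶ 𝟙_ C), IsUniversalForm H l by
    obtain ⟨S, ⟨τ⟩⟩ := exists_partialTrace h
    exact ⟨τ.relativeSerreFunctor⟩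
  intro m
  have := M.isFinite.additive_right m
  have := M.isFinite.linear_right m
  have : (H.ihom m).Additive := (H.adj m).right_adjoint_additive
  have : (H.ihom m).Linear k := linear_right_adjoint (H.adj m)
  have (X : C) : ((curriedAction C C).obj X).Additive :=
    inferInstanceAs ((tensorLeft X).Additive)
  have : PreservesFiniteColimits (H.ihom m) := M.preservesFiniteColimits _
  have hC := FiniteTensorCategory.finite (k := k) (C := C)
  have := M.isFinite.finite.isLeftAdjoint (H.ihom m) hC.finite_hom
  let adj := Adjunction.ofIsLeftAdjoint (H.ihom m)
  -- With the counit as form, universality is the adjunction bijection between n ⟶ R 𝟙 and Hom(m, n)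
  -- ⟶ 𝟙, where R is right adjoint to Hom(m, -).
  refine ⟨(H.ihom m).rightAdjoint.obj (𝟙_ C), adj.counit.app (𝟙_ C), fun n => ?_⟩
  convert! (adj.homEquiv n (𝟙_ C)).symm.bijective using 2

end FiniteTensor

/-! ### Twisted module structures -/

section

variable {C : Type u₁} [Category.{v₁} C] [MonoidalCategory C]
  {M : Type u₂} [Category.{v₂} M] [MonoidalLeftAction C M]

/-- Morphisms n ⟶ p are the 𝟙-valued points of Hom(n, p), so Yoneda applies. -/
lemma InternalHom.isIso_of_isIso_map (H : InternalHom C M) {a b : M} (f : a ⟶ b)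
    (h : ∀ n, IsIso ((H.ihom n).map f)) : IsIso f := by
  refine isIso_of_yoneda_map_bijective _ fun n => ?_
  let e (p : M) : (n ⟶ p) ≃ (𝟙_ C ⟶ H.hom n p) :=
    { toFun x := H.curry ((λₗ n).hom ≫ x)
      invFun y := (λₗ n).inv ≫ H.uncurry y
      left_inv x := by simp
      right_inv y := by simp }
  have he : (fun x : n ⟶ a => x ≫ f) =
      (e b).symm ∘ (fun y => y ≫ (H.ihom n).map f) ∘ e a := by
    funext x
    simp [e, H.uncurry_map]
  rw [he]
  exact (e b).symm.bijective.comp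
    ((asIso ((H.ihom n).map f)).homToEquiv.bijective.comp (e a).bijective)

end

section Twist

open MonoidalLeftAction

attribute [local instance] dualPairing

variable {C : Type u₁} [Category.{v₁} C] [MonoidalCategory C] [RigidCategory C]
  {M : Type u₂} [Category.{v₂} M] [MonoidalLeftAction C M] {H : InternalHom C M}

lemma comp_coname {Z Z' X : C} (f : Z' ⟶ Z) (t : Z ⊗ X ⟶ 𝟙_ C) :
    coname (f ▷ X ≫ t) = f ≫ coname t :=
  pair_injective (by rw [← whiskerRight_pair, pair_coname, pair_coname])

lemma coname_whiskerLeft {Z X X' : C} (f : X ⟶ X') (t : Z ⊗ X' ⟶ 𝟙_ C) :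
    coname (Z ◁ f ≫ t) = coname t ≫ dualMap f :=
  pair_injective (by rw [pair_dualMap, pair_coname, pair_coname])

lemma dualMap_id (X : C) : dualMap (𝟙 X) = 𝟙 (dual X) :=
  pair_injective (by
    rw [← Category.id_comp (dualMap _), pair_dualMap, whiskerLeft_id, Category.id_comp])

lemma dualMap_comp {X Y Z : C} (f : X ⟶ Y) (g : Y ⟶ Z) :
    dualMap (f ≫ g) = dualMap g ≫ dualMap f :=
  pair_injective (by
    rw [pair_dualMap, ← Category.id_comp (dualMap g), pair_dualMap,
      ← Category.id_comp (dualMap (f ≫ g)), pair_dualMap, MonoidalCategory.whiskerLeft_comp,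
      Category.assoc])

instance {X Y : C} (f : X ⟶ Y) [IsIso f] : IsIso (dualMap f) :=
  ⟨dualMap (inv f), by rw [← dualMap_comp, IsIso.inv_hom_id, dualMap_id],
    by rw [← dualMap_comp, IsIso.hom_inv_id, dualMap_id]⟩

lemma pair_contract {B W Z X : C} (e : B ⊗ W ⟶ 𝟙_ C) (r : Z ⟶ W ⊗ dual X) :
    pair (B ◁ r ≫ (α_ _ _ _).inv ≫ e ▷ dual X ≫ (λ_ _).hom) =
      (α_ B Z X).hom ≫ B ◁ unbend r ≫ e := by
  have h : e ▷ (dual X ⊗ X) ≫ 𝟙_ C ◁ dualEval X = (B ⊗ W) ◁ dualEval X ≫ e ▷ 𝟙_ C :=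
    (whisker_exchange _ _).symm
  calc _ = (α_ B Z X).hom ≫ B ◁ r ▷ X ⊗≫ (e ▷ (dual X ⊗ X) ≫ 𝟙_ C ◁ dualEval X) ≫ (λ_ _).hom := by
        rw [pair]; monoidal
    _ = _ := by rw [h, unbend_eq]; monoidal

/-- The monoidal structure of the double dual, seen through evaluation: evaluating a bent form
against (X ⊗ Y)** amounts to bending and evaluating Y, then X. It is the source of the tensor
coherence of ξ. -/
lemma coname_tensor {X Y Z : C} (t : (Z ⊗ X) ⊗ Y ⟶ 𝟙_ C) :
    dual (dual (X ⊗ Y)) ◁ coname ((α_ Z X Y).inv ≫ t) ≫ dualEval (dual (X ⊗ Y)) =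
      doubleDualTensor X Y ▷ Z ≫ (α_ _ _ _).hom ≫ dual (dual X) ◁ coname ((α_ _ Z X).hom ≫
        dual (dual Y) ◁ coname t ≫ dualEval (dual Y)) ≫ dualEval (dual X) := by
  obtain ⟨r, hr⟩ : ∃ r : Z ⟶ dual Y ⊗ dual X, unbend r = coname t :=
    ⟨_, (tensorRightHomEquiv _ _ _ _).symm_apply_apply _⟩
  have h₁ : coname ((α_ Z X Y).inv ≫ t) = r ≫ (dualTensorIso X Y).inv := pair_injective (by
    have h := pair_dualTensorIso (r ≫ (dualTensorIso X Y).inv)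
    rw [Category.assoc, Iso.inv_hom_id, Category.comp_id, hr, pair_coname] at h
    rw [pair_coname, h, Iso.inv_hom_id_assoc])
  have h₂ : coname ((α_ (dual (dual Y)) Z X).hom ≫
      dual (dual Y) ◁ coname t ≫ dualEval (dual Y)) = _ ◁ r ≫ (α_ _ _ _).inv ≫
        dualEval (dual Y) ▷ dual X ≫ (λ_ _).hom := pair_injective (by
    rw [pair_coname, pair_contract, hr])
  have h₃ := dualTensorIso_eval (dual Y) (dual X)
  rw [h₁, h₂, MonoidalCategory.whiskerLeft_comp, Category.assoc, ← dualMap_eval, ← h₃,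
    doubleDualTensor]
  simp only [MonoidalCategory.whiskerLeft_comp, comp_whiskerRight, Category.assoc]
  rw [← associator_naturality_right_assoc, ← whisker_exchange_assoc, ← whisker_exchange_assoc]

lemma coname_unit {Y : C} (t : Y ⟶ 𝟙_ C) :
    dual (dual (𝟙_ C)) ◁ coname ((ρ_ Y).hom ≫ t) ≫ dualEval (dual (𝟙_ C)) =
      doubleDualUnit (C := C) ▷ Y ≫ (λ_ Y).hom ≫ t := by
  have h₁ : coname ((ρ_ Y).hom ≫ t) = t ≫ (dualUnitIso (C := C)).inv := pair_injective (by
    rw [pair_coname, ← whiskerRight_pair, pair, ← dualUnitIso_eval]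
    simp)
  rw [h₁, MonoidalCategory.whiskerLeft_comp, Category.assoc, ← dualMap_eval, ← dualUnitIso_eval,
    ← leftUnitor_naturality, ← whisker_exchange_assoc, doubleDualUnit, ← unitors_equal]
  simp only [comp_whiskerRight, Category.assoc]

/-! ### Existence, uniqueness and coherence of twist maps. -/

namespace PartialTrace

variable {S : M ⥤ M} (τ : PartialTrace H S)

/-- The trace condition which characterizes the twisted module structure. -/
def IsTwistMap {X : C} {m : M} (ξ : dual (dual X) ⊙ₗ S.obj m ⟶ S.obj (X ⊙ₗ m)) : Prop :=
  ∀ (Y : C) (h : Y ⊙ₗ X ⊙ₗ m ⟶ S.obj m),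
    τ.tr ((αₗ (dual (dual X)) Y (X ⊙ₗ m)).hom ≫ dual (dual X) ⊴ₗ h ≫ ξ) =
      dual (dual X) ◁ coname (τ.tr ((αₗ Y X m).hom ≫ h)) ≫ dualEval (dual X)

variable {τ}

lemma IsTwistMap.ext {X : C} {m : M} {ξ ξ' : dual (dual X) ⊙ₗ S.obj m ⟶ S.obj (X ⊙ₗ m)}
    (h : τ.IsTwistMap ξ) (h' : τ.IsTwistMap ξ') : ξ = ξ' :=
  τ.hom_ext_action fun Y b => (h Y b).trans (h' Y b).symm

lemma tr_twist_comp {X : C} {m : M} (ξ : dual (dual X) ⊙ₗ S.obj m ⟶ S.obj (X ⊙ₗ m)) {Y Y' : C}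
    (f : Y' ⟶ Y) (h : Y ⊙ₗ X ⊙ₗ m ⟶ S.obj m) :
    τ.tr ((αₗ (dual (dual X)) Y' (X ⊙ₗ m)).hom ≫ dual (dual X) ⊴ₗ (f ⊵ₗ (X ⊙ₗ m) ≫ h) ≫ ξ) =
      dual (dual X) ◁ f ≫
        τ.tr ((αₗ (dual (dual X)) Y (X ⊙ₗ m)).hom ≫ dual (dual X) ⊴ₗ h ≫ ξ) := by
  rw [comp_tr, reassoc_of% actionAssoc_naturality_middle, actionHomRight_comp_assoc]

lemma coname_tr_comp {X : C} {m : M} {Y Y' : C} (f : Y' ⟶ Y) (h : Y ⊙ₗ X ⊙ₗ m ⟶ S.obj m) :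
    coname (τ.tr ((αₗ Y' X m).hom ≫ f ⊵ₗ (X ⊙ₗ m) ≫ h)) =
      f ≫ coname (τ.tr ((αₗ Y X m).hom ≫ h)) := by
  rw [← comp_coname, comp_tr, reassoc_of% actionAssoc_naturality_left]

/-- The trace condition for `h` implies that for `f ⊵ₗ (X ⊙ₗ m) ≫ h`. -/
lemma tr_twist_of_comp {X : C} {m : M} {ξ : dual (dual X) ⊙ₗ S.obj m ⟶ S.obj (X ⊙ₗ m)} {Y Y' : C}
    {h : Y ⊙ₗ X ⊙ₗ m ⟶ S.obj m}
    (hh : τ.tr ((αₗ (dual (dual X)) Y (X ⊙ₗ m)).hom ≫ dual (dual X) ⊴ₗ h ≫ ξ) =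
      dual (dual X) ◁ coname (τ.tr ((αₗ Y X m).hom ≫ h)) ≫ dualEval (dual X))
    {h' : Y' ⊙ₗ X ⊙ₗ m ⟶ S.obj m} (f : Y' ⟶ Y) (hf : f ⊵ₗ (X ⊙ₗ m) ≫ h = h') :
    τ.tr ((αₗ (dual (dual X)) Y' (X ⊙ₗ m)).hom ≫ dual (dual X) ⊴ₗ h' ≫ ξ) =
      dual (dual X) ◁ coname (τ.tr ((αₗ Y' X m).hom ≫ h')) ≫ dualEval (dual X) := by
  rw [← hf, tr_twist_comp, coname_tr_comp, hh, MonoidalCategory.whiskerLeft_comp, Category.assoc]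

-- Nondegeneracy solves the trace condition for the universal h, the internal evaluation; every
-- other h is its pullback along `curry h`.
variable (τ) in
lemma exists_isTwistMap (X : C) (m : M) :
    ∃ ξ : dual (dual X) ⊙ₗ S.obj m ⟶ S.obj (X ⊙ₗ m), τ.IsTwistMap ξ := by
  obtain ⟨ξ, hξ⟩ := (τ.bijective_tr (dual (dual X)) (X ⊙ₗ m) (S.obj m)).2
    (dual (dual X) ◁ coname (τ.tr ((αₗ (H.hom (X ⊙ₗ m) (S.obj m)) X m).hom ≫
      H.ev (X ⊙ₗ m) (S.obj m))) ≫ dualEval (dual X))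
  exact ⟨ξ, fun Y h => tr_twist_of_comp hξ (H.curry h) (H.curry_ev h)⟩

lemma IsTwistMap.naturality {X X' : C} {m m' : M}
    {ξ : dual (dual X) ⊙ₗ S.obj m ⟶ S.obj (X ⊙ₗ m)}
    {ξ' : dual (dual X') ⊙ₗ S.obj m' ⟶ S.obj (X' ⊙ₗ m')}
    (hξ : τ.IsTwistMap ξ) (hξ' : τ.IsTwistMap ξ') (f : X ⟶ X') (g : m ⟶ m') :
    (dualMap (dualMap f) ⊙ₗₘ S.map g) ≫ ξ' = ξ ≫ S.map (f ⊙ₗₘ g) := by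
  refine τ.hom_ext_action fun Y b => ?_
  have h₁ : coname (τ.tr ((αₗ Y X m).hom ≫ Y ⊴ₗ (f ⊙ₗₘ g) ≫ b)) =
      coname (τ.tr ((αₗ Y X' m').hom ≫ b ≫ S.map g)) ≫ dualMap f := by
    rw [← coname_whiskerLeft, ← Category.assoc _ b, τ.tr_map, comp_tr, actionHom_def,
      reassoc_of% actionAssoc_naturality_right, reassoc_of% actionAssoc_naturality_middle,
      ← actionHomRight_comp_assoc]
  have h₂ := hξ Y (Y ⊴ₗ (f ⊙ₗₘ g) ≫ b)
  have h₃ := hξ' Y (b ≫ S.map g)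
  have h₄ : τ.tr ((αₗ (dual (dual X)) Y (X' ⊙ₗ m')).hom ≫ dual (dual X) ⊴ₗ b ≫ ξ ≫
      S.map (f ⊙ₗₘ g)) = τ.tr ((αₗ (dual (dual X)) Y (X ⊙ₗ m)).hom ≫
        dual (dual X) ⊴ₗ (Y ⊴ₗ (f ⊙ₗₘ g) ≫ b) ≫ ξ) := by
    rw [actionHomRight_comp_assoc, ← reassoc_of% actionAssoc_naturality_right, ← τ.tr_map]
    simp only [Category.assoc]
  rw [h₄, h₂, h₁, actionHom_def', Category.assoc, ← actionHomRight_comp_assoc,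
    action_exchange_assoc, ← reassoc_of% actionAssoc_naturality_left, ← comp_tr, h₃,
    MonoidalCategory.whiskerLeft_comp, Category.assoc, ← dualMap_eval (dualMap f),
    whisker_exchange_assoc]

lemma IsTwistMap.tensor {X Y : C} {m : M}
    {ξ : dual (dual X) ⊙ₗ S.obj (Y ⊙ₗ m) ⟶ S.obj (X ⊙ₗ Y ⊙ₗ m)}
    {ξ' : dual (dual Y) ⊙ₗ S.obj m ⟶ S.obj (Y ⊙ₗ m)}
    {ξ'' : dual (dual (X ⊗ Y)) ⊙ₗ S.obj m ⟶ S.obj ((X ⊗ Y) ⊙ₗ m)}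
    (hξ : τ.IsTwistMap ξ) (hξ' : τ.IsTwistMap ξ') (hξ'' : τ.IsTwistMap ξ'') :
    ξ'' ≫ S.map (αₗ X Y m).hom =
      doubleDualTensor X Y ⊵ₗ S.obj m ≫ (αₗ (dual (dual X)) (dual (dual Y)) (S.obj m)).hom ≫
        dual (dual X) ⊴ₗ ξ' ≫ ξ := by
  refine τ.hom_ext_action fun Z b => ?_
  have h₀ : τ.tr ((αₗ Z (X ⊗ Y) m).hom ≫ Z ⊴ₗ (αₗ X Y m).hom ≫ b) =
      (α_ Z X Y).inv ≫ τ.tr ((αₗ (Z ⊗ X) Y m).hom ≫ (αₗ Z X (Y ⊙ₗ m)).hom ≫ b) := by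
    rw [comp_tr, ← associator_actionHom_assoc, inv_hom_actionHomLeft_assoc]
  have h₁ := hξ'' Z (Z ⊴ₗ (αₗ X Y m).hom ≫ b)
  have h₂ := hξ (dual (dual Y) ⊗ Z) ((αₗ _ _ _).hom ≫ dual (dual Y) ⊴ₗ b ≫ ξ')
  have h₃ := hξ' (Z ⊗ X) ((αₗ _ _ _).hom ≫ b)
  have h₄ : τ.tr ((αₗ (dual (dual (X ⊗ Y))) Z (X ⊙ₗ Y ⊙ₗ m)).hom ≫ dual (dual (X ⊗ Y)) ⊴ₗ b ≫
      ξ'' ≫ S.map (αₗ X Y m).hom) = τ.tr ((αₗ (dual (dual (X ⊗ Y))) Z ((X ⊗ Y) ⊙ₗ m)).hom ≫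
        dual (dual (X ⊗ Y)) ⊴ₗ (Z ⊴ₗ (αₗ X Y m).hom ≫ b) ≫ ξ'') := by
    rw [actionHomRight_comp_assoc, ← reassoc_of% actionAssoc_naturality_right, ← τ.tr_map]
    simp only [Category.assoc]
  have h₅ : τ.tr ((αₗ (dual (dual Y) ⊗ Z) X (Y ⊙ₗ m)).hom ≫ (αₗ _ _ _).hom ≫
      dual (dual Y) ⊴ₗ b ≫ ξ') = (α_ _ _ _).hom ≫ τ.tr ((αₗ (dual (dual Y)) (Z ⊗ X) (Y ⊙ₗ m)).hom ≫
        dual (dual Y) ⊴ₗ ((αₗ _ _ _).hom ≫ b) ≫ ξ') := by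
    rw [comp_tr, actionHomRight_comp_assoc, associator_actionHom_assoc]
  rw [h₄, h₁, h₀, coname_tensor, ← h₃, ← h₅, ← h₂, comp_tr, comp_tr, action_exchange_assoc,
    ← reassoc_of% actionAssoc_naturality_left, reassoc_of% actionAssoc_naturality_right,
    ← associator_actionHom_assoc]
  simp only [actionHomRight_comp, Category.assoc]

lemma IsTwistMap.unit {m : M} {ξ : dual (dual (𝟙_ C)) ⊙ₗ S.obj m ⟶ S.obj (𝟙_ C ⊙ₗ m)}
    (hξ : τ.IsTwistMap ξ) :
    ξ ≫ S.map (λₗ m).hom = doubleDualUnit (C := C) ⊵ₗ S.obj m ≫ (λₗ (S.obj m)).hom := by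
  refine τ.hom_ext_action fun Y b => ?_
  have h₁ := hξ Y (Y ⊴ₗ (λₗ m).hom ≫ b)
  have h₂ : τ.tr ((αₗ (dual (dual (𝟙_ C))) Y m).hom ≫ dual (dual (𝟙_ C)) ⊴ₗ b ≫
      ξ ≫ S.map (λₗ m).hom) = τ.tr ((αₗ (dual (dual (𝟙_ C))) Y (𝟙_ C ⊙ₗ m)).hom ≫
        dual (dual (𝟙_ C)) ⊴ₗ (Y ⊴ₗ (λₗ m).hom ≫ b) ≫ ξ) := by
    rw [actionHomRight_comp_assoc, ← reassoc_of% actionAssoc_naturality_right, ← τ.tr_map]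
    simp only [Category.assoc]
  rw [h₂, h₁, ← rightUnitor_actionHom_assoc, ← comp_tr, coname_unit, comp_tr, comp_tr,
    action_exchange_assoc, ← reassoc_of% actionAssoc_naturality_left, leftUnitor_actionHom_assoc,
    ← actionUnitIso_hom_naturality]

end PartialTrace

/-! ### Left module compatibility of `φ` as a trace condition. -/

namespace RelativeSerreFunctor

open PartialTrace

variable (𝒮 : RelativeSerreFunctor H)

/-- The compatibility of a morphism `ξ` with the left module structures. -/
def IsTwistMapAt {X : C} {m : M} (n : M) (ξ : dual (dual X) ⊙ₗ 𝒮.S.obj m ⟶ 𝒮.S.obj (X ⊙ₗ m)) :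
    Prop :=
  (𝒮.φ (X ⊙ₗ m) n).hom =
    dualMap (H.rightMod X m n) ≫ (dualTensorIso (H.hom m n) (dual X)).hom ≫
      dual (dual X) ◁ (𝒮.φ m n).hom ≫ H.leftMod (dual (dual X)) n (𝒮.S.obj m) ≫
        (H.ihom n).map ξ

/-- The test morphism of the trace condition. -/
noncomputable def testHom (X : C) (m n : M) :
    (dual (H.hom m n) ⊗ H.hom m n ⊗ dual X) ⊙ₗ X ⊙ₗ m ⟶ 𝒮.S.obj m :=
  (αₗ _ _ _).hom ≫ dual (H.hom m n) ⊴ₗ H.uncurry (H.rightMod X m n) ≫ H.uncurry (𝒮.φ m n).hom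

lemma tr_testHom (X : C) (m n : M) : 𝒮.trace.tr ((αₗ _ X m).hom ≫ 𝒮.testHom X m n) =
    pair ((α_ _ _ _).inv ≫ dualEval (H.hom m n) ▷ dual X ≫ (λ_ _).hom) := by
  have h₁ := (pair_contract (dualEval (H.hom m n)) (𝟙 (H.hom m n ⊗ dual X)))
  have h₂ := 𝒮.pair_eq_tr (𝟙 (dual (H.hom m n)))
  rw [whiskerLeft_id, Category.id_comp] at h₁
  rw [pair_id, Category.id_comp] at h₂
  have h₃ : H.uncurry (H.rightMod X m n) =
      (αₗ _ _ _).inv ≫ unbend (𝟙 (H.hom m n ⊗ dual X)) ⊵ₗ m ≫ H.ev m n := by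
    have h := H.uncurry_comp_rightMod (X := X) (𝟙 (H.hom m n ⊗ dual X))
    rwa [Category.id_comp] at h
  rw [h₁, h₂, comp_tr, comp_tr, testHom, h₃, actionHomRight_comp_assoc,
    actionHomRight_comp_assoc, reassoc_of% actionAssoc_naturality_middle,
    ← associator_actionHom_assoc,
    actionHomRight_hom_inv_assoc]

/-- Both sides of the compatibility at n are compared by their traces against Hom(X ⊙ₗ m, n). After
the invertible 𝔟 is inserted and the invertible `p` is removed, what remains is the trace condition
for the one morphism `testHom`. -/
lemma isTwistMapAt_iff {X : C} {m : M} (n : M)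
    (ξ : dual (dual X) ⊙ₗ 𝒮.S.obj m ⟶ 𝒮.S.obj (X ⊙ₗ m)) :
    𝒮.IsTwistMapAt n ξ ↔
      𝒮.trace.tr ((αₗ (dual (dual X)) _ (X ⊙ₗ m)).hom ≫
        dual (dual X) ⊴ₗ 𝒮.testHom X m n ≫ ξ) =
      dual (dual X) ◁ coname (𝒮.trace.tr ((αₗ _ X m).hom ≫ 𝒮.testHom X m n)) ≫
        dualEval (dual X) := by
  let p : dual (H.hom (X ⊙ₗ m) n) ⟶ dual (dual X) ⊗ dual (H.hom m n) :=
    dualMap (H.rightMod X m n) ≫ (dualTensorIso (H.hom m n) (dual X)).hom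
  let F := p ≫ (dual (dual X) ◁ (𝒮.φ m n).hom ≫ H.leftMod (dual (dual X)) n (𝒮.S.obj m)) ≫
    (H.ihom n).map ξ
  have hp : IsIso p := inferInstance
  have h₀ : 𝒮.IsTwistMapAt n ξ ↔ (𝒮.φ (X ⊙ₗ m) n).hom = F := by
    simp only [IsTwistMapAt, F, p, Category.assoc]
  have h₁ : dual (H.hom (X ⊙ₗ m) n) ◁ H.rightMod X m n ≫ 𝒮.trace.tr ((αₗ _ _ _).hom ≫
      _ ⊴ₗ H.ev (X ⊙ₗ m) n ≫ H.uncurry F) = p ▷ _ ≫ (α_ _ _ _).hom ≫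
        𝒮.trace.tr ((αₗ (dual (dual X)) _ (X ⊙ₗ m)).hom ≫
          dual (dual X) ⊴ₗ 𝒮.testHom X m n ≫ ξ) := by
    have h : H.rightMod X m n ⊵ₗ (X ⊙ₗ m) ≫ H.ev (X ⊙ₗ m) n = H.uncurry (H.rightMod X m n) := rfl
    rw [comp_tr, comp_tr, comp_tr, reassoc_of% actionAssoc_naturality_middle,
      ← actionHomRight_comp_assoc, h, H.uncurry_comp, H.uncurry_map,
      H.uncurry_whiskerLeft_leftMod, testHom, actionHomRight_comp_assoc,
      actionHomRight_comp_assoc, associator_actionHom_assoc,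
      ← reassoc_of% actionAssoc_naturality_right, reassoc_of% actionAssoc_naturality_left,
      ← action_exchange_assoc, Category.assoc]
  have h₂ : dual (H.hom (X ⊙ₗ m) n) ◁ H.rightMod X m n ≫ 𝒮.trace.tr ((αₗ _ _ _).hom ≫
      _ ⊴ₗ H.ev (X ⊙ₗ m) n ≫ H.uncurry (𝒮.φ (X ⊙ₗ m) n).hom) = p ▷ _ ≫ (α_ _ _ _).hom ≫
        dual (dual X) ◁ coname (𝒮.trace.tr ((αₗ _ X m).hom ≫ 𝒮.testHom X m n)) ≫
          dualEval (dual X) := by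
    have h := 𝒮.pair_eq_tr (𝟙 (dual (H.hom (X ⊙ₗ m) n)))
    rw [Category.id_comp] at h
    rw [← h, ← pair_dualMap, Category.id_comp, tr_testHom, coname_pair, pair, ← dualTensorIso_eval,
      comp_whiskerRight_assoc]
  rw [h₀, ← cancel_epi (α_ _ _ _).hom, ← cancel_epi (p ▷ _), ← h₁, ← h₂, cancel_epi]
  exact ⟨fun h => by rw [h], fun h => 𝒮.trace.eq_of_tr h.symm⟩

/-- The object n = S m suffices: inserting the element of Hom(m, S m)* that `φ` sends to the
identity of S m, every h becomes a pullback of the test morphism. -/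
lemma exists_comp_testHom {X Y : C} {m : M} (h : Y ⊙ₗ X ⊙ₗ m ⟶ 𝒮.S.obj m) :
    ∃ y, y ⊵ₗ (X ⊙ₗ m) ≫ 𝒮.testHom X m (𝒮.S.obj m) = h := by
  let c : Y ⟶ H.hom m (𝒮.S.obj m) ⊗ dual X := H.curry h ≫ inv (H.rightMod X m (𝒮.S.obj m))
  let j : 𝟙_ C ⟶ _ := H.curry (λₗ (𝒮.S.obj m)).hom ≫ (𝒮.φ m (𝒮.S.obj m)).inv
  have hc : c ⊵ₗ (X ⊙ₗ m) ≫ H.uncurry (H.rightMod X m (𝒮.S.obj m)) = h := by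
    rw [← H.uncurry_comp, Category.assoc, IsIso.inv_hom_id, Category.comp_id, H.uncurry_curry]
  have hj : j ⊵ₗ 𝒮.S.obj m ≫ H.uncurry (𝒮.φ m (𝒮.S.obj m)).hom = (λₗ (𝒮.S.obj m)).hom := by
    rw [← H.uncurry_comp, Category.assoc, Iso.inv_hom_id, Category.comp_id, H.uncurry_curry]
  refine ⟨(λ_ Y).inv ≫ j ▷ Y ≫ _ ◁ c, ?_⟩
  rw [testHom, comp_actionHomLeft, comp_actionHomLeft, Category.assoc, Category.assoc,
    reassoc_of% actionAssoc_naturality_middle, ← actionHomRight_comp_assoc, hc,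
    reassoc_of% actionAssoc_naturality_left, ← action_exchange_assoc, hj,
    ← actionUnitIso_hom_naturality,
    ← leftUnitor_actionHom_assoc, inv_hom_actionHomLeft_assoc]

lemma isTwistMap_iff {X : C} {m : M} (ξ : dual (dual X) ⊙ₗ 𝒮.S.obj m ⟶ 𝒮.S.obj (X ⊙ₗ m)) :
    𝒮.trace.IsTwistMap ξ ↔ ∀ n, 𝒮.IsTwistMapAt n ξ := by
  refine ⟨fun h n => (𝒮.isTwistMapAt_iff n ξ).2 (h _ _), fun h Y f => ?_⟩
  obtain ⟨y, hy⟩ := 𝒮.exists_comp_testHom f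
  exact PartialTrace.tr_twist_of_comp ((𝒮.isTwistMapAt_iff _ ξ).1 (h _)) y hy

/-- In the compatibility of `φ` all factors except Hom(n, ξ) are known to be invertible, so Hom(n,
ξ) is invertible for every n. -/
lemma isIso_of_isTwistMap {X : C} {m : M} {ξ : dual (dual X) ⊙ₗ 𝒮.S.obj m ⟶ 𝒮.S.obj (X ⊙ₗ m)}
    (h : 𝒮.trace.IsTwistMap ξ) : IsIso ξ := by
  refine H.isIso_of_isIso_map ξ fun n => ?_
  have h' : (dualMap (H.rightMod X m n) ≫ (dualTensorIso (H.hom m n) (dual X)).hom ≫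
      dual (dual X) ◁ (𝒮.φ m n).hom ≫ H.leftMod (dual (dual X)) n (𝒮.S.obj m)) ≫
        (H.ihom n).map ξ = (𝒮.φ (X ⊙ₗ m) n).hom := by
    simpa using ((𝒮.isTwistMap_iff ξ).1 h n).symm
  exact IsIso.of_isIso_fac_left h'

lemma existsUnique_twist : ∃! t : TwistedModuleStructure C 𝒮.S, 𝒮.IsTwist t := by
  choose ξ hξ using 𝒮.trace.exists_isTwistMap
  have (X : C) (m : M) : IsIso (ξ X m) := 𝒮.isIso_of_isTwistMap (hξ X m)
  refine ⟨{ ξ := fun X m => asIso (ξ X m)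
            ξ_naturality := fun f _ _ g => (hξ _ _).naturality (hξ _ _) f g
            ξ_tensor := fun X Y m => (hξ _ _).tensor (hξ _ _) (hξ _ _)
            ξ_unit := fun m => (hξ _ _).unit },
    fun X m n => (𝒮.isTwistMap_iff _).1 (hξ X m) n, fun t ht => ?_⟩
  have h (X : C) (m : M) : t.ξ X m = asIso (ξ X m) :=
    Iso.ext (((𝒮.isTwistMap_iff _).2 (ht X m)).ext (hξ X m))
  obtain ⟨ξ', _, _, _⟩ := t
  obtain rfl : ξ' = fun X m => asIso (ξ X m) := funext₂ h
  rfl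

end RelativeSerreFunctor

end Twist

/-! ### Right adjoints of module functors -/

section Doctrinal

open MonoidalLeftAction Functor.LaxLeftLinear Functor.OplaxLeftLinear

variable {C : Type u₁} [Category.{v₁} C] [MonoidalCategory C]
  {M : Type u₂} [Category.{v₂} M] [MonoidalLeftAction C M]
  {N : Type u₃} [Category.{v₃} N] [MonoidalLeftAction C N]

/-- A lax module functor with invertible structure morphisms is strong. -/
noncomputable abbrev leftLinearOfIsIso (G : N ⥤ M) [G.LaxLeftLinear C]
    [∀ (X : C) (n : N), IsIso (μₗ G X n)] : G.LeftLinear C where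
  δₗ X n := inv (μₗ G X n)
  δₗ_naturality_left f n := by
    rw [IsIso.comp_inv_eq, Category.assoc, μₗ_naturality_left, IsIso.inv_hom_id_assoc]
  δₗ_naturality_right X _ _ f := by
    rw [IsIso.comp_inv_eq, Category.assoc, μₗ_naturality_right, IsIso.inv_hom_id_assoc]
  δₗ_associativity X Y n := by
    have : IsIso (X ⊴ₗ μₗ G Y n) :=
      inferInstanceAs (IsIso (((curriedAction C M).obj X).map (μₗ G Y n)))
    rw [IsIso.inv_comp_eq, ← cancel_mono (X ⊴ₗ μₗ G Y n ≫ μₗ G X (Y ⊙ₗ n)), Category.assoc,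
      ← μₗ_associativity]
    simp only [Category.assoc]
    rw [← actionHomRight_comp_assoc, IsIso.inv_hom_id, actionHomRight_id, Category.id_comp,
      IsIso.inv_hom_id, Category.comp_id]
  δₗ_unitality_inv n := by
    rw [IsIso.eq_comp_inv, μₗ_unitality_inv]
  μₗ_comp_δₗ X n := IsIso.hom_inv_id _
  δₗ_comp_μₗ X n := IsIso.inv_hom_id _

section Adjunction

variable {M : Type u₂} [Category.{v₂} M] {N : Type u₃} [Category.{v₃} N] {F : M ⥤ N} {G : N ⥤ M}
  (adj : F ⊣ G)

/-- The counit `F (G n) ⟶ n` of an adjunction. -/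
def counitAt (n : N) : F.obj (G.obj n) ⟶ n := adj.counit.app n

/-- The morphism `F m ⟶ n` corresponding to `f : m ⟶ G n`. -/
def transpose {m : M} {n : N} (f : m ⟶ G.obj n) : F.obj m ⟶ n := F.map f ≫ counitAt adj n

lemma homEquiv_symm_eq_transpose {m : M} {n : N} (f : m ⟶ G.obj n) :
    (adj.homEquiv m n).symm f = transpose adj f :=
  adj.homEquiv_counit ..

lemma transpose_homEquiv {m : M} {n : N} (f : F.obj m ⟶ n) :
    transpose adj (adj.homEquiv m n f) = f := by
  rw [← homEquiv_symm_eq_transpose, Equiv.symm_apply_apply]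

lemma transpose_injective {m : M} {n : N} {f g : m ⟶ G.obj n}
    (h : transpose adj f = transpose adj g) : f = g :=
  (adj.homEquiv _ _).symm.injective (by simpa only [homEquiv_symm_eq_transpose] using h)

lemma transpose_comp {m m' : M} {n : N} (g : m' ⟶ m) (f : m ⟶ G.obj n) :
    transpose adj (g ≫ f) = F.map g ≫ transpose adj f := by
  simp [transpose]

lemma transpose_map {m : M} {n n' : N} (f : m ⟶ G.obj n) (g : n ⟶ n') :
    transpose adj (f ≫ G.map g) = transpose adj f ≫ g := by
  have h : F.map (G.map g) ≫ counitAt adj n' = counitAt adj n ≫ g := adj.counit.naturality g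
  simp [transpose, h]

lemma transpose_map_id {n n' : N} (g : n ⟶ n') :
    transpose adj (G.map g) = counitAt adj n ≫ g := 
  adj.counit.naturality g

/-- The unit `m ⟶ G (F m)` of an adjunction. -/
def unitAt (m : M) : m ⟶ G.obj (F.obj m) := adj.unit.app m

lemma transpose_unitAt (m : M) : transpose adj (unitAt adj m) = 𝟙 (F.obj m) :=
  adj.left_triangle_components m

end Adjunction

variable {F : M ⥤ N} {G : N ⥤ M} (adj : F ⊣ G) [F.LeftLinear C]

/-- The structure morphism of a right adjoint of a module functor. -/
def mateLineator (X : C) (n : N) : X ⊙ₗ G.obj n ⟶ G.obj (X ⊙ₗ n) :=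
  adj.homEquiv _ _ (δₗ F X (G.obj n) ≫ X ⊴ₗ counitAt adj n)

lemma transpose_mateLineator (X : C) (n : N) :
    transpose adj (mateLineator adj X n) = δₗ F X (G.obj n) ≫ X ⊴ₗ counitAt adj n :=
  transpose_homEquiv _ _

lemma unitAt_action (X : C) (m : M) : unitAt adj (X ⊙ₗ m) =
    X ⊴ₗ unitAt adj m ≫ mateLineator adj X (F.obj m) ≫ G.map (μₗ F X m) :=
  transpose_injective adj (by
    rw [transpose_unitAt, transpose_comp, transpose_map, transpose_mateLineator, Category.assoc,
      δₗ_naturality_right_assoc, ← actionHomRight_comp_assoc, ← transpose, transpose_unitAt,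
      actionHomRight_id, Category.id_comp, Functor.LeftLinear.δₗ_comp_μₗ])

/-- A right adjoint of a module functor is a lax module functor. -/
abbrev mateLaxLeftLinear : G.LaxLeftLinear C where
  μₗ X n := mateLineator adj X n
  μₗ_naturality_left f n := transpose_injective adj (by
    rw [transpose_comp, transpose_map, transpose_mateLineator, transpose_mateLineator,
      δₗ_naturality_left_assoc, Category.assoc, action_exchange])
  μₗ_naturality_right X _ _ f := transpose_injective adj (by
    rw [transpose_comp, transpose_map, transpose_mateLineator, transpose_mateLineator,
      δₗ_naturality_right_assoc, ← actionHomRight_comp, Category.assoc, ← actionHomRight_comp,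
      ← transpose_map_id, transpose])
  μₗ_associativity X Y n := transpose_injective adj (by
    rw [transpose_map, transpose_comp, transpose_comp, transpose_mateLineator,
      transpose_mateLineator, δₗ_naturality_right_assoc, ← actionHomRight_comp,
      ← transpose, transpose_mateLineator, actionHomRight_comp, ← δₗ_associativity_assoc,
      Category.assoc, actionAssoc_naturality_right])
  μₗ_unitality n := transpose_injective adj (by
    rw [transpose_map, transpose_mateLineator, Category.assoc, ← actionUnitIso_hom_naturality,
      δₗ_unitality_hom_assoc, transpose])

end Doctrinal

/-! ### Existence of right adjoints in Rex_C. -/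

section FiniteTensor

open MonoidalLeftAction Functor.LaxLeftLinear Functor.OplaxLeftLinear

variable {k : Type w} [Field k] {C : Type u₁} [Category.{v₁} C] [Abelian C] [Linear k C]
  [MonoidalCategory C] [RigidCategory C] [FiniteTensorCategory k C]

/-- The mate structure on the right adjoint G is a priori only lax; rigidity makes it strong, and
exactness of its source N makes G right exact. -/
lemma Rex.nonempty_rightAdjoint {M N : ExactModuleCategory.{w, v₁, u₁, v₂, u₂} k C}
    (F : Rex M N) : Nonempty F.RightAdjoint := by
  have := M.isFinite.finite.isLeftAdjoint F.functor N.isFinite.finite.finite_hom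
  let G := F.functor.rightAdjoint
  let adj : F.functor ⊣ G := Adjunction.ofIsLeftAdjoint F.functor
  let : G.LaxLeftLinear C := mateLaxLeftLinear adj
  have (X : C) (n : N) : IsIso (μₗ G X n) := isIso_lineator X Xᘁ G n
  let : G.LeftLinear C := leftLinearOfIsIso G
  have : G.Additive := adj.right_adjoint_additive
  have := linear_right_adjoint (k := k) adj
  have (X : C) := M.isFinite.additive_left X
  have (m : M) := M.isFinite.rightExact_right m
  have := N.preservesFiniteColimits G
  refine ⟨⟨⟨G⟩, adj, unitAt_action adj, fun X n => ?_⟩⟩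
  change μₗ F.functor X (G.obj n) ≫ transpose adj (mateLineator adj X n) = X ⊴ₗ counitAt adj n
  rw [transpose_mateLineator, Functor.LeftLinear.μₗ_comp_δₗ_assoc]

end FiniteTensor

/-! ### The comparison morphism of partial traces -/

section ActionTranspose

open MonoidalLeftAction Functor.LaxLeftLinear

variable {C : Type u₁} [Category.{v₁} C] [MonoidalCategory C]
  {M : Type u₂} [Category.{v₂} M] [MonoidalLeftAction C M]
  {N : Type u₃} [Category.{v₃} N] [MonoidalLeftAction C N]
  {F : M ⥤ N} {G : N ⥤ M} (adj : F ⊣ G)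

section Lax

variable [F.LaxLeftLinear C]

/-- The morphism `Y ⊙ₗ F m ⟶ n` corresponding to `f : Y ⊙ₗ m ⟶ G n`. -/
def actionTranspose {Y : C} {m : M} {n : N} (f : Y ⊙ₗ m ⟶ G.obj n) : Y ⊙ₗ F.obj m ⟶ n :=
  μₗ F Y m ≫ transpose adj f

lemma actionTranspose_comp_left {Y Y' : C} {m : M} {n : N} (g : Y' ⟶ Y) (f : Y ⊙ₗ m ⟶ G.obj n) :
    actionTranspose adj (g ⊵ₗ m ≫ f) = g ⊵ₗ F.obj m ≫ actionTranspose adj f := by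
  rw [actionTranspose, transpose_comp, ← μₗ_naturality_left_assoc, actionTranspose]

lemma actionTranspose_comp_right {Y : C} {m m' : M} {n : N} (g : m' ⟶ m) (f : Y ⊙ₗ m ⟶ G.obj n) :
    actionTranspose adj (Y ⊴ₗ g ≫ f) = Y ⊴ₗ F.map g ≫ actionTranspose adj f := by
  rw [actionTranspose, transpose_comp, ← μₗ_naturality_right_assoc, actionTranspose]

lemma actionTranspose_map {Y : C} {m : M} {n n' : N} (f : Y ⊙ₗ m ⟶ G.obj n) (g : n ⟶ n') :
    actionTranspose adj (f ≫ G.map g) = actionTranspose adj f ≫ g := by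
  rw [actionTranspose, transpose_map, actionTranspose, Category.assoc]

lemma actionTranspose_assoc {X Y : C} {m : M} {n : N} (f : Y ⊙ₗ X ⊙ₗ m ⟶ G.obj n) :
    actionTranspose adj ((αₗ Y X m).hom ≫ f) =
      (αₗ Y X (F.obj m)).hom ≫ Y ⊴ₗ μₗ F X m ≫ actionTranspose adj f := by
  rw [actionTranspose, transpose_comp, μₗ_associativity_assoc, actionTranspose]

/-- The hypothesis `h` says that the counit is a module morphism; it lets X pass through the
transposition. -/
lemma actionTranspose_action [G.LaxLeftLinear C]
    (h : ∀ (X : C) (n : N), μₗ F X (G.obj n) ≫ transpose adj (μₗ G X n) = X ⊴ₗ counitAt adj n)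
    {X Y : C} {m : M} {n : N} (f : Y ⊙ₗ m ⟶ G.obj n) :
    actionTranspose adj ((αₗ X Y m).hom ≫ X ⊴ₗ f ≫ μₗ G X n) =
      (αₗ X Y (F.obj m)).hom ≫ X ⊴ₗ actionTranspose adj f := by
  rw [actionTranspose_assoc, actionTranspose, transpose_comp, ← μₗ_naturality_right_assoc, h,
    actionTranspose, transpose, actionHomRight_comp, actionHomRight_comp]

end Lax

lemma actionTranspose_surjective [F.LeftLinear C] {Y : C} {m : M} {n : N} (b : Y ⊙ₗ F.obj m ⟶ n) :
    ∃ f : Y ⊙ₗ m ⟶ G.obj n, actionTranspose adj f = b :=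
  ⟨adj.homEquiv _ _ (Functor.OplaxLeftLinear.δₗ F Y m ≫ b), by
    rw [actionTranspose, transpose_homEquiv, Functor.LeftLinear.μₗ_comp_δₗ_assoc]⟩

end ActionTranspose

/-! ### Comparison of partial traces along F ⊣ G ⊣ G'. -/

namespace PartialTrace

open MonoidalLeftAction

variable {C : Type u₁} [Category.{v₁} C] [MonoidalCategory C]
  {M : Type u₂} [Category.{v₂} M] [MonoidalLeftAction C M]
  {N : Type u₃} [Category.{v₃} N] [MonoidalLeftAction C N]
  {HM : InternalHom C M} {HN : InternalHom C N} {S : M ⥤ M} {T : N ⥤ N}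

/-- A family of forms natural in Y is determined by its value at the internal evaluation, which the
universal form represents. -/
lemma exists_tr_eq {H : InternalHom C M} (τ : PartialTrace H S) {m n : M}
    (t : ∀ {Y : C}, (Y ⊙ₗ m ⟶ n) → (Y ⟶ 𝟙_ C))
    (ht : ∀ {Y Y' : C} (g : Y' ⟶ Y) (b : Y ⊙ₗ m ⟶ n), t (g ⊵ₗ m ≫ b) = g ≫ t b) :
    ∃ u : n ⟶ S.obj m, ∀ (Y : C) (b : Y ⊙ₗ m ⟶ n), τ.tr (b ≫ u) = t b := by
  obtain ⟨u, hu⟩ := (τ.universal m n).2 (t (H.ev m n))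
  refine ⟨u, fun Y b => ?_⟩
  dsimp only at hu
  rw [← H.curry_ev b, ht, ← hu, ← tr_ev_comp, comp_tr, Category.assoc]

variable (τ : PartialTrace HM S) (σ : PartialTrace HN T) {F : M ⥤ N} {G : N ⥤ M} (adj : F ⊣ G)
  [F.LeftLinear C]

lemma exists_comparison (m : M) : ∃ v : G.obj (T.obj (F.obj m)) ⟶ S.obj m,
    ∀ (Y : C) (f : Y ⊙ₗ m ⟶ G.obj (T.obj (F.obj m))),
      τ.tr (f ≫ v) = σ.tr (actionTranspose adj f) :=
  τ.exists_tr_eq (fun f => σ.tr (actionTranspose adj f)) fun g f => by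
    rw [actionTranspose_comp_left, comp_tr]

/-- The morphism `G (T (F m)) ⟶ S m` under which the partial traces correspond. -/
noncomputable def comparison (m : M) : G.obj (T.obj (F.obj m)) ⟶ S.obj m :=
  (τ.exists_comparison σ adj m).choose

lemma tr_comp_comparison {Y : C} {m : M} (f : Y ⊙ₗ m ⟶ G.obj (T.obj (F.obj m))) :
    τ.tr (f ≫ τ.comparison σ adj m) = σ.tr (actionTranspose adj f) :=
  (τ.exists_comparison σ adj m).choose_spec Y f

lemma tr_map_comparison {Y : C} {m : M} {n : N} (f : Y ⊙ₗ m ⟶ G.obj n) (u : n ⟶ T.obj (F.obj m)) :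
    τ.tr (f ≫ G.map u ≫ τ.comparison σ adj m) = σ.tr (actionTranspose adj f ≫ u) := by
  rw [← Category.assoc, tr_comp_comparison, actionTranspose_map]

lemma comparison_naturality {m m' : M} (g : m ⟶ m') :
    G.map (T.map (F.map g)) ≫ τ.comparison σ adj m' = τ.comparison σ adj m ≫ S.map g :=
  τ.hom_ext fun Y f => by
    rw [tr_map_comparison, tr_map, ← Category.assoc, tr_map, ← Category.assoc,
      tr_comp_comparison, actionTranspose_comp_right]

/-- Both sides classify the same data: natural forms on the morphisms Y ⊙ₗ F m ⟶ n, or, after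
transposition, on the morphisms Y ⊙ₗ m ⟶ G n. -/
lemma bijective_map_comparison (m : M) (n : N) : Function.Bijective
    fun u : n ⟶ T.obj (F.obj m) => G.map u ≫ τ.comparison σ adj m := by
  refine ⟨fun u u' h => σ.hom_ext fun Y b => ?_, fun w => ?_⟩
  · obtain ⟨f, rfl⟩ := actionTranspose_surjective adj b
    dsimp only at h
    rw [← tr_map_comparison τ, h, tr_map_comparison]
  · choose f hf using fun (Y : C) (b : Y ⊙ₗ F.obj m ⟶ n) => actionTranspose_surjective adj b
    have hf' {Y : C} (g : Y ⊙ₗ m ⟶ G.obj n) : f Y (actionTranspose adj g) = g :=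
      transpose_injective adj ((cancel_epi (Functor.LaxLeftLinear.μₗ F Y m)).1 (hf _ _))
    obtain ⟨u, hu⟩ := σ.exists_tr_eq (fun {Y} b => τ.tr (f Y b ≫ w)) fun {Y Y'} g b => by
      rw [comp_tr, ← Category.assoc, ← hf' (g ⊵ₗ m ≫ f Y b), actionTranspose_comp_left, hf]
    refine ⟨u, τ.hom_ext fun Y g => ?_⟩
    rw [tr_map_comparison, hu, hf']

variable {G' : M ⥤ N} (adj' : G ⊣ G')

/-- The morphism `T (F m) ⟶ G' (S m)` for iterated right adjoints `F ⊣ G ⊣ G'`. -/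
noncomputable def comparisonHom (m : M) : T.obj (F.obj m) ⟶ G'.obj (S.obj m) :=
  adj'.homEquiv _ _ (τ.comparison σ adj m)

lemma transpose_comparisonHom (m : M) :
    transpose adj' (τ.comparisonHom σ adj adj' m) = τ.comparison σ adj m :=
  transpose_homEquiv adj' _

/-- Composition with this map is the preceding bijection followed by that of G ⊣ G', so Yoneda
applies. -/
instance (m : M) : IsIso (τ.comparisonHom σ adj adj' m) :=
  isIso_of_yoneda_map_bijective _ fun n => by
    simp only [comparisonHom, ← adj'.homEquiv_naturality_left]
    exact (adj'.homEquiv _ _).bijective.comp (τ.bijective_map_comparison σ adj m n)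

/-- The isomorphism `T ∘ F ≅ G' ∘ S` for iterated right adjoints `F ⊣ G ⊣ G'`. -/
noncomputable def comparisonIso : F ⋙ T ≅ S ⋙ G' :=
  NatIso.ofComponents (fun m => asIso (τ.comparisonHom σ adj adj' m)) fun {m m'} g => by
    change T.map (F.map g) ≫ τ.comparisonHom σ adj adj' m' =
      τ.comparisonHom σ adj adj' m ≫ G'.map (S.map g)
    refine transpose_injective adj' ?_
    rw [transpose_comp, transpose_map, transpose_comparisonHom, transpose_comparisonHom,
      comparison_naturality]

end PartialTrace

/-! ### The comparison isomorphism of module functors -/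

section Comparison

open MonoidalLeftAction Functor.LaxLeftLinear

variable {k : Type w} [Field k] {C : Type u₁} [Category.{v₁} C]
  [Abelian C] [Linear k C] [MonoidalCategory C]
  {L M N : ExactModuleCategory.{w, v₁, u₁, v₂, u₂} k C}

namespace Rex

lemma RightAdjoint.lineator_transpose {F : Rex M N} (G : F.RightAdjoint) (X : C) (n : N) :
    μₗ F.functor X (G.right.functor.obj n) ≫ transpose G.adj (μₗ G.right.functor X n) =
      X ⊴ₗ counitAt G.adj n :=
  G.counit_app X n

lemma RightAdjoint.transpose_map_app {F₁ F₂ : Rex M N} (G₁ : F₁.RightAdjoint)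
    (G₂ : F₂.RightAdjoint) (α : F₁.functor ⟶ F₂.functor) {m : M} {n : N}
    (f : m ⟶ G₂.right.functor.obj n) :
    transpose G₁.adj (f ≫ (G₁.map G₂ α).app n) = α.app m ≫ transpose G₂.adj f := by
  have h : transpose G₁.adj ((G₁.map G₂ α).app n) =
      α.app (G₂.right.functor.obj n) ≫ counitAt G₂.adj n :=
    conjugateEquiv_counit G₂.adj G₁.adj α n
  rw [transpose_comp, h, transpose, α.naturality_assoc]

lemma RightAdjoint.actionTranspose_map_app {F₁ F₂ : Rex M N} (G₁ : F₁.RightAdjoint)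
    (G₂ : F₂.RightAdjoint) {α : F₁.functor ⟶ F₂.functor} (hα : IsModuleHom α) {Y : C} {m : M}
    {n : N} (f : Y ⊙ₗ m ⟶ G₂.right.functor.obj n) :
    actionTranspose G₁.adj (f ≫ (G₁.map G₂ α).app n) =
      Y ⊴ₗ α.app m ≫ actionTranspose G₂.adj f := by
  rw [actionTranspose, transpose_map_app, reassoc_of% hα Y m, actionTranspose]

lemma RightAdjoint.transpose_γ {E : Rex L M} {F : Rex M N} (E' : E.RightAdjoint)
    (F' : F.RightAdjoint) (K : (E.comp F).RightAdjoint) {l : L} {n : N}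
    (f : l ⟶ E'.right.functor.obj (F'.right.functor.obj n)) :
    transpose K.adj (f ≫ (E'.γ F' K).hom.app n) = transpose F'.adj (transpose E'.adj f) := by
  refine (transpose_comp K.adj f _).trans ?_
  refine (congrArg ((E.comp F).functor.map f ≫ ·)
    (Adjunction.rightAdjointUniq_hom_app_counit (E'.adj.comp F'.adj) K.adj n)).trans ?_
  simp [transpose, counitAt, comp]

lemma RightAdjoint.actionTranspose_γ {E : Rex L M} {F : Rex M N} (E' : E.RightAdjoint)
    (F' : F.RightAdjoint) (K : (E.comp F).RightAdjoint) {Y : C} {l : L} {n : N}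
    (f : Y ⊙ₗ l ⟶ E'.right.functor.obj (F'.right.functor.obj n)) :
    actionTranspose K.adj (f ≫ (E'.γ F' K).hom.app n) =
      actionTranspose F'.adj (actionTranspose E'.adj f) := by
  have h : μₗ (E.comp F).functor Y l =
    μₗ F.functor Y (E.functor.obj l) ≫ F.functor.map (μₗ E.functor Y l) := rfl
  rw [actionTranspose, transpose_γ, h, actionTranspose, actionTranspose, transpose_comp]
  exact Category.assoc ..

end Rex

variable [RigidCategory C]

/-- The comparison isomorphisms `S_N ∘ F ≅ Fʳʳ ∘ S_M`. -/
noncomputable def comparisonFamily : ComparisonFamily.{w, v₁, u₁, v₂, u₂} k C :=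
  fun _ _ _ _ 𝒮 𝒯 _ G G' => 𝒮.trace.comparisonIso 𝒯.trace G.adj G'.adj

open PartialTrace

lemma isNatural_comparisonFamily : (comparisonFamily (k := k) (C := C)).IsNatural := by
  intro M N HM HN 𝒮 𝒯 F₁ F₂ G₁ G₁' G₂ G₂' α hα
  ext m
  change 𝒯.S.map (α.app m) ≫ 𝒮.trace.comparisonHom 𝒯.trace G₂.adj G₂'.adj m =
    𝒮.trace.comparisonHom 𝒯.trace G₁.adj G₁'.adj m ≫
      (G₂'.map G₁' (G₁.map G₂ α)).app (𝒮.S.obj m)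
  refine transpose_injective G₂'.adj ?_
  rw [transpose_comp, G₂'.transpose_map_app, transpose_comparisonHom, transpose_comparisonHom]
  refine 𝒮.trace.hom_ext fun Y f => ?_
  rw [tr_map_comparison, tr_map, ← Category.assoc, tr_comp_comparison,
    G₁.actionTranspose_map_app G₂ hα]

lemma isTwistedModuleHom_comparisonFamily :
    (comparisonFamily (k := k) (C := C)).IsTwistedModuleHom := by
  intro M N HM HN 𝒮 𝒯 s t hs ht F G G' X m
  let A := dual (dual X)
  let G₀ := G.right.functor
  have hs' : 𝒮.trace.IsTwistMap (s.ξ X m).hom := (𝒮.isTwistMap_iff _).2 (hs X m)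
  have ht' : 𝒯.trace.IsTwistMap (t.ξ X (F.functor.obj m)).hom :=
    (𝒯.isTwistMap_iff _).2 (ht X (F.functor.obj m))
  let v := 𝒮.trace.comparison 𝒯.trace G.adj m
  let u := (t.ξ X (F.functor.obj m)).hom ≫ 𝒯.S.map (μₗ F.functor X m)
  change (t.ξ X (F.functor.obj m)).hom ≫ 𝒯.S.map (μₗ F.functor X m) ≫
    𝒮.trace.comparisonHom 𝒯.trace G.adj G'.adj (X ⊙ₗ m) =
      A ⊴ₗ 𝒮.trace.comparisonHom 𝒯.trace G.adj G'.adj m ≫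
        μₗ G'.right.functor A (𝒮.S.obj m) ≫ G'.right.functor.map (s.ξ X m).hom
  refine transpose_injective G'.adj ?_
  -- The structure morphism of Fʳ is invertible. Precomposing with it lets A leave Fʳ on both sides,
  -- so that both are tested on A ⊙ₗ Fʳ (T (F m)).
  rw [← cancel_epi (μₗ G₀ A _), ← Category.assoc (t.ξ X _).hom, transpose_comp,
    transpose_comp, transpose_map, ← μₗ_naturality_right_assoc,
    reassoc_of% G'.lineator_transpose, ← actionHomRight_comp_assoc, ← transpose,
    transpose_comparisonHom, transpose_comparisonHom]
  refine 𝒮.trace.hom_ext_action fun Y h => ?_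
  -- The left side is computed with the trace condition of the target twist, the right side (`h₄`)
  -- with that of the source twist; transposition identifies the two bent traces.
  have h₂ : 𝒮.trace.tr ((αₗ A Y (X ⊙ₗ m)).hom ≫ A ⊴ₗ h ≫ μₗ G₀ A _ ≫ G₀.map u ≫
      𝒮.trace.comparison 𝒯.trace G.adj (X ⊙ₗ m)) =
      A ◁ coname (𝒯.trace.tr ((αₗ Y X (F.functor.obj m)).hom ≫
        Y ⊴ₗ μₗ F.functor X m ≫ actionTranspose G.adj h)) ≫ dualEval (dual X) := by
    have h₃ := 𝒮.trace.tr_map_comparison 𝒯.trace G.adj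
      ((αₗ A Y (X ⊙ₗ m)).hom ≫ A ⊴ₗ h ≫ μₗ G₀ A _) u
    simp only [Category.assoc] at h₃
    rw [h₃, actionTranspose_action G.adj G.lineator_transpose, ← ht',
      ← Category.assoc _ (t.ξ _ _).hom, tr_map, actionHomRight_comp, Category.assoc, Category.assoc,
      reassoc_of% actionAssoc_naturality_right]
  have h₄ := hs' Y (h ≫ v)
  rw [actionHomRight_comp_assoc, ← Category.assoc _ h, tr_comp_comparison,
    actionTranspose_assoc] at h₄
  exact h₂.trans h₄.symm

/-- Transposed along R, both sides have as trace that of a transposed morphism, in two stages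
through F ∘ E on one side and in one stage on the other; these agree by the definition of γ. -/
lemma isCompatibleWithComp_comparisonFamily :
    (comparisonFamily (k := k) (C := C)).IsCompatibleWithComp := by
  intro L M N HL HM HN ℛ 𝒮 𝒯 E E' E'' F F' F'' K' K'' R l
  change 𝒮.trace.comparisonHom 𝒯.trace F'.adj F''.adj (E.functor.obj l) ≫
      F''.right.functor.map (ℛ.trace.comparisonHom 𝒮.trace E'.adj E''.adj l) ≫
        (F''.γ E'' R).hom.app (ℛ.S.obj l) =
    ℛ.trace.comparisonHom 𝒯.trace K'.adj K''.adj l ≫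
      (R.map K'' (E'.γ F' K').hom).app (ℛ.S.obj l)
  let c := 𝒮.trace.comparisonHom 𝒯.trace F'.adj F''.adj (E.functor.obj l)
  let d := ℛ.trace.comparisonHom 𝒮.trace E'.adj E''.adj l
  have h₁ : transpose R.adj ((c ≫ F''.right.functor.map d) ≫ (F''.γ E'' R).hom.app (ℛ.S.obj l)) =
      E'.right.functor.map (𝒮.trace.comparison 𝒯.trace F'.adj (E.functor.obj l)) ≫
        ℛ.trace.comparison 𝒮.trace E'.adj l := by
    rw [F''.transpose_γ E'' R, transpose_map, transpose_comp, transpose_comparisonHom,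
      transpose_comparisonHom]
  have h₂ : transpose R.adj (ℛ.trace.comparisonHom 𝒯.trace K'.adj K''.adj l ≫
      (R.map K'' (E'.γ F' K').hom).app (ℛ.S.obj l)) = (E'.γ F' K').hom.app _ ≫
        ℛ.trace.comparison 𝒯.trace K'.adj l := by
    rw [R.transpose_map_app, transpose_comparisonHom]
  have h₃ : E'.right.functor.map (𝒮.trace.comparison 𝒯.trace F'.adj (E.functor.obj l)) ≫
        ℛ.trace.comparison 𝒮.trace E'.adj l = (E'.γ F' K').hom.app _ ≫
        ℛ.trace.comparison 𝒯.trace K'.adj l := by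
    refine ℛ.trace.hom_ext fun Y f => ?_
    rw [tr_map_comparison, tr_comp_comparison]
    refine Eq.trans ?_ (congrArg _ (Category.assoc ..))
    rw [tr_comp_comparison]
    exact congrArg _ (E'.actionTranspose_γ F' K' f).symm
  refine (Category.assoc ..).symm.trans (transpose_injective R.adj ?_)
  exact h₁.trans (h₃.trans h₂.symm)

end Comparison

end RelativeSerre

theorem mainTheorem8 (k : Type w) [Field k] [IsAlgClosed k]
    (C : Type u₁) [Category.{v₁} C] [Abelian C] [Linear k C] [MonoidalCategory C] [RigidCategory C]
    [FiniteTensorCategory k C] :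
    (∀ M : ExactModuleCategory.{w, v₁, u₁, v₂, u₂} k C, Nonempty (InternalHom C M) ∧
      ∀ H : InternalHom C M, Nonempty (RelativeSerreFunctor H) ∧
        ∀ 𝒮 : RelativeSerreFunctor H, ∃! t : TwistedModuleStructure C 𝒮.S, 𝒮.IsTwist t) ∧
    (∀ (M N : ExactModuleCategory.{w, v₁, u₁, v₂, u₂} k C) (F : Rex M N),
      Nonempty F.RightAdjoint) ∧
    ∃ θ : ComparisonFamily.{w, v₁, u₁, v₂, u₂} k C,
      θ.IsNatural ∧ θ.IsTwistedModuleHom ∧ θ.IsCompatibleWithComp := by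
  refine ⟨fun M => ⟨M.nonempty_internalHom, fun H => ⟨M.nonempty_relativeSerreFunctor H,
    fun 𝒮 => 𝒮.existsUnique_twist⟩⟩, fun M N F => F.nonempty_rightAdjoint, comparisonFamily,
    isNatural_comparisonFamily, isTwistedModuleHom_comparisonFamily,
    isCompatibleWithComp_comparisonFamily⟩
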